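/- Let $f$ be a probability density on $\mathbb{R}$ with distribution $F$ and characteristic function $\phi_f(t)=\int e^{ity}f(y)\,dy$, and let $\lambda>0$ be known. Let $X_1,X_2,\ldots$ be independent observations with $X_i=Y_i+Z_i$, where, for each $i$, $Y_i$ and $Z_i$ are independent, $Z_i$ is standard normal, and $Y_i$ is distributed as $\sum_{j=1}^{N}W_j$, with $N$ Poisson distributed with parameter $\lambda$ and independent of the i.i.d. random variables $W_1,W_2,\ldots$ with density $f$. For $n\ge 1$ let $\phi_{emp}(t)=\frac1n\sum_{j=1}^n e^{itX_j}$, let $w(x)=\sin x/(\pi x)$ be the sinc kernel, with Fourier transform $\phi_w=1_{[-1,1]}$, and let $h=h_n>0$ be a bandwidth. Put $$f_{nh}(x)=\frac{1}{2\pi\lambda}\int_{-1/h}^{1/h}e^{-itx}\operatorname{Log}\left(\frac{\phi_{emp}(t)\phi_w(ht)}{e^{-\lambda}e^{-t^2/2}}\right)dt ,$$ where $\operatorname{Log}\psi$ denotes the distinguished logarithm of $\psi$ on $[-1/h,1/h]$, i.e. the continuous function $L$ on $[-1/h,1/h]$ with $e^{L}=\psi$ whose value at $0$ is the principal logarithm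 of $\psi(0)$ (here $L(0)=\lambda$). On the event where the distinguished logarithm does not exist, $f_{nh}(x)$ is assigned an arbitrary (measurable) real value, e.g. zero. Let $$\hat f_{nh}(x)=(M_n\wedge f_{nh}(x))\vee(-M_n).$$ Assume that $\phi_f$ is integrable, that $h_n\sim(\log n)^{-\beta}$ as $n\to\infty$ for some $0<\beta<1/2$, that $M_n=C\log n$ for some constant $C>0$, and that $\int|y|^{\rho}f(y)\,dy<\infty$ for some $\rho>3/2$. Then for every fixed $x\in\mathbb{R}$ the estimator $\hat f_{nh}(x)$ is integrable for every $n$, and $$\frac{\sqrt n}{h\,e^{1/(2h^2)}}\left(\hat f_{nh}(x)-\operatorname{E}[\hat f_{nh}(x)]\right)\ \stackrel{\mathcal D}{\longrightarrow}\ \mathcal N\left(0,\frac{e^{2\lambda}}{2\pi^2\lambda^2}\right)\qquad (n\to\infty).$$ -/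

import Mathlib

open MeasureTheory ProbabilityTheory Filter Topology Asymptotics
open scoped NNReal ENNReal

namespace GaussDecompounding

noncomputable section

/-- The law of the Poisson sum `∑_{j=1}^{N} W_j`, where `N` is Poisson distributed with mean `lam`,
the `W_j` are i.i.d. with law `F`, and `N` is independent of `(W_j)`. -/
def compoundPoisson (lam : ℝ≥0) (F : Measure ℝ) : Measure ℝ :=
  ((poissonMeasure lam).prod (Measure.infinitePi fun _ : ℕ => F)).map
    fun p => ∑ j ∈ Finset.range p.1, p.2 j

/-- The empirical characteristic function `t ↦ (1/n) ∑_{j=1}^n exp (i t s_j)` of the first `n` terms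
of the sequence `s`. -/
def empCharFun (s : ℕ → ℝ) (n : ℕ) (t : ℝ) : ℂ :=
  (1 / (n : ℂ)) * ∑ j ∈ Finset.range n, Complex.exp (Complex.I * t * s j)

/-- The sinc kernel `w(x) = sin x / (π x)`, with `w(0) = 1 / π`. -/
def sincKernel (x : ℝ) : ℝ := Real.sinc x / Real.pi

/-- The Fourier transform of the sinc kernel, that is, the indicator function of `[-1, 1]`; the
sinc kernel is square integrable but not integrable, and `sincKernel_eq_inverse_fourier` recovers
it from this function by Fourier inversion. -/
def sincKernelFT (t : ℝ) : ℂ := (Set.Icc (-1 : ℝ) 1).indicator (fun _ => (1 : ℂ)) t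

theorem sincKernel_eq_inverse_fourier (x : ℝ) :
    (sincKernel x : ℂ) =
      (1 / (2 * Real.pi)) * ∫ t : ℝ, Complex.exp (-(Complex.I * t * x)) * sincKernelFT t := by
  have e : (fun t : ℝ => Complex.exp (-(Complex.I * t * x)) * sincKernelFT t) =
      (Set.Icc (-1 : ℝ) 1).indicator fun t : ℝ => Complex.exp (-(Complex.I * x) * t) := by
    funext t
    by_cases ht : t ∈ Set.Icc (-1 : ℝ) 1
    · simp only [sincKernelFT, Set.indicator_of_mem ht, mul_one]; congr 1; ring
    · simp [sincKernelFT, Set.indicator_of_notMem ht]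
  have hp : (Real.pi : ℂ) ≠ 0 := Complex.ofReal_ne_zero.2 Real.pi_ne_zero
  rw [e, integral_indicator measurableSet_Icc, integral_Icc_eq_integral_Ioc,
    ← intervalIntegral.integral_of_le (by norm_num : (-1 : ℝ) ≤ 1)]
  by_cases hx : x = 0
  · subst hx
    simp only [sincKernel, Real.sinc_zero]
    norm_num
    ring
  · have hx' : (x : ℂ) ≠ 0 := Complex.ofReal_ne_zero.2 hx
    rw [integral_exp_mul_complex (by simpa using hx')]
    simp only [sincKernel, Real.sinc_of_ne_zero hx]
    push_cast
    rw [Complex.sin]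
    rw [show -(Complex.I * x) * (1 : ℂ) = -x * Complex.I by ring,
      show -(Complex.I * x) * (-1 : ℂ) = x * Complex.I by ring]
    field_simp
    ring_nf
    simp only [Complex.I_sq]
    ring

/-- `L` is the distinguished logarithm of `ψ` on `[-T, T]`: a continuous function on `[-T, T]` with
`exp ∘ L = ψ` there, whose value at `0` is the principal logarithm of `ψ 0`. -/
structure IsDistLog (ψ : ℝ → ℂ) (T : ℝ) (L : ℝ → ℂ) : Prop where
  continuousOn : ContinuousOn L (Set.Icc (-T) T)
  exp_eq : ∀ t ∈ Set.Icc (-T) T, Complex.exp (L t) = ψ t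
  zero_eq : L 0 = Complex.log (ψ 0)

/-- The function `t ↦ φ_emp(t) φ_w(h t) / (e^{-λ} e^{-t²/2})`. -/
def deconvRatio (phiW : ℝ → ℂ) (lam : ℝ) (s : ℕ → ℝ) (n : ℕ) (h : ℝ) (t : ℝ) : ℂ :=
  empCharFun s n t * phiW (h * t) / (Real.exp (-lam) * Real.exp (-t ^ 2 / 2) : ℝ)

open scoped Classical in
/-- The plug-in estimator `f_{nh}(x)`: if the distinguished logarithm of `deconvRatio` on
`[-1/h, 1/h]` exists, its value is
`(1 / (2πλ)) ∫_{-1/h}^{1/h} e^{-itx} Log (φ_emp(t) φ_w(h t) / (e^{-λ} e^{-t²/2})) dt`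
(a real number, because the logarithm takes conjugate values at `t` and `-t`), and otherwise it is
the prescribed value `d`. -/
def plugInEstimator (phiW : ℝ → ℂ) (lam : ℝ) (s : ℕ → ℝ) (n : ℕ) (h x d : ℝ) : ℝ :=
  if H : ∃ L : ℝ → ℂ, IsDistLog (deconvRatio phiW lam s n h) (1 / h) L then
    (1 / (2 * Real.pi * lam)) *
      (∫ t in (-(1 / h))..(1 / h), Complex.exp (-(Complex.I * t * x)) * H.choose t).re
  else d

/-- The truncated estimator `(M ∧ f_{nh}(x)) ∨ (-M)`. -/
def truncEstimator (phiW : ℝ → ℂ) (lam : ℝ) (s : ℕ → ℝ) (n : ℕ) (h x d M : ℝ) : ℝ :=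
  max (min M (plugInEstimator phiW lam s n h x d)) (-M)

end

end GaussDecompounding

namespace GaussDecompounding

/-! Write `T = 1/h`. The observations have characteristic function `exp(-λ + λφ(t)) exp(-t²/2)`,
where `φ = φ_f`; its reciprocal is `invMixCF`. As long as the empirical characteristic function is
uniformly close to it on `[-T, T]`, the distinguished logarithm equals `λφ` plus the principal
logarithm of the ratio `r` of the two, and `log r = (r - 1) + O(|r - 1|²)`. The estimator is then a
deterministic term, plus the centred sample mean of i.i.d. variables `linStat(X_j)`, plus a
quadratic remainder (`abs_plugInEstimator_sub_linear_le`).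

The summand explains the rate and the variance. The weight `exp(t²/2)` on `[-T, T]` puts almost all
its mass within distance of order `1/T` from the endpoints, and there `φ` is negligible by the
Riemann-Lebesgue lemma. After multiplication by `T exp(-T²/2)` the summand is therefore close in
mean to `e^λ/(πλ) · cos(T(X - x))` (`abs_scaledStat_sub_cos_le`). The characteristic function of `X`
vanishes at infinity, so this cosine has mean tending to `0` and mean square tending to `1/2`, which
yields the variance `e^{2λ}/(2π²λ²)`. The rescaled summands are uniformly bounded, so a central
limit theorem for triangular arrays applies (`tendstoInDistribution_sum_triangular`).

The remainder is controlled in `L¹`, which makes centring at the expectation harmless. The quadratic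
part is of order `T² exp(T²/2)/√n` after normalization; it vanishes because `β < 1/2` gives `T² =
o(log n)`. The event where the approximation fails has probability `O(1/n)`, by Hoeffding's
inequality on a grid and a Lipschitz bound between grid points
(`exists_measurableSet_norm_empCharFun_sub_le`). There the truncation bounds the estimator by `C log
n`, and `√n · log n / n` tends to `0`. On the good event the untruncated estimator is `O(1 + T)`,
because `φ` is integrable, so the truncation is eventually inactive. -/

/-! ### Compound Poisson laws and the law of the jumps -/

lemma measurable_poissonSum :
    Measurable fun p : ℕ × (ℕ → ℝ) => ∑ j ∈ Finset.range p.1, p.2 j := by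
  refine measurable_from_prod_countable_right fun k : ℕ => ?_
  exact Finset.measurable_fun_sum (Finset.range k) fun i _ => measurable_pi_apply i

instance isProbabilityMeasure_compoundPoisson (lam : ℝ≥0) (F : Measure ℝ)
    [IsProbabilityMeasure F] : IsProbabilityMeasure (compoundPoisson lam F) :=
  Measure.isProbabilityMeasure_map measurable_poissonSum.aemeasurable

lemma charFun_map_sum_infinitePi (F : Measure ℝ) [IsProbabilityMeasure F] (k : ℕ) (t : ℝ) :
    charFun ((Measure.infinitePi fun _ : ℕ => F).map fun w => ∑ j ∈ Finset.range k, w j) t =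
      charFun F t ^ k := by
  have hi : iIndepFun (fun (i : ℕ) (w : ℕ → ℝ) => w i) (Measure.infinitePi fun _ : ℕ => F) :=
    iIndepFun_infinitePi (X := fun _ x => x) (fun _ => measurable_id)
  rw [(hi.restrict _).charFun_map_fun_finsetSum_eq_prod
    (fun i _ => (measurable_pi_apply i).aemeasurable)]
  simp [Measure.infinitePi_map_eval]

/-- The characteristic function of a compound Poisson law. -/
lemma charFun_compoundPoisson (lam : ℝ≥0) (F : Measure ℝ) [IsProbabilityMeasure F] (t : ℝ) :
    charFun (compoundPoisson lam F) t = Complex.exp (lam * (charFun F t - 1)) := by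
  have hm := measurable_poissonSum
  rw [charFun_apply_real, compoundPoisson, integral_map hm.aemeasurable (by fun_prop),
    integral_prod]
  · have (k : ℕ) : ∫ w : ℕ → ℝ, Complex.exp (t * (∑ j ∈ Finset.range k, w j : ℝ) * Complex.I)
        ∂(Measure.infinitePi fun _ : ℕ => F) = charFun F t ^ k := by
      rw [← charFun_map_sum_infinitePi, charFun_apply_real, integral_map (by fun_prop)
        (by fun_prop)]
    simp_rw [this]
    rw [integral_poissonMeasure]
    calc ∑' n : ℕ, (Real.exp (-lam) * (lam : ℝ) ^ n / (n.factorial)) • charFun F t ^ n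
      _ = ∑' n : ℕ, (Real.exp (-lam) : ℂ) * ((lam * charFun F t) ^ n / n.factorial) := by
        congr with n
        rw [mul_pow, Complex.real_smul]
        push_cast
        ring
      _ = Real.exp (-lam) * Complex.exp (lam * charFun F t) := by
        rw [tsum_mul_left, (NormedSpace.expSeries_div_hasSum_exp (lam * charFun F t)).tsum_eq,
          Complex.exp_eq_exp_ℂ]
      _ = _ := by
        rw [Complex.ofReal_exp, ← Complex.exp_add]
        push_cast
        ring_nf
  · have hc : Continuous fun y : ℝ => Complex.exp (t * y * Complex.I) := by fun_prop
    refine Integrable.of_bound (C := 1) (hc.measurable.comp hm).aestronglyMeasurable (ae_of_all _ fun p => ?_)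
    rw [← Complex.ofReal_mul, Complex.norm_exp_ofReal_mul_I]

/-- A compound Poisson law with integrable jumps has a finite mean. -/
lemma integrable_id_compoundPoisson (lam : ℝ≥0) (F : Measure ℝ) [IsProbabilityMeasure F]
    (hF : Integrable id F) : Integrable id (compoundPoisson lam F) := by
  have hm := measurable_poissonSum
  have hw (i : ℕ) : Integrable (fun w : ℕ → ℝ => w i) (Measure.infinitePi fun _ : ℕ => F) := by
    have := (measurePreserving_eval_infinitePi (fun _ : ℕ => F) i).integrable_comp
      hF.aestronglyMeasurable
    exact this.2 hF
  have hwn (i : ℕ) : ∫ w : ℕ → ℝ, ‖w i‖ ∂(Measure.infinitePi fun _ : ℕ => F) = ∫ y, ‖y‖ ∂F := by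
    have h := (measurePreserving_eval_infinitePi (fun _ : ℕ => F) i)
    have := integral_map (μ := Measure.infinitePi fun _ : ℕ => F) h.measurable.aemeasurable
      (f := fun y : ℝ => ‖y‖) (by fun_prop)
    rw [h.map_eq] at this
    exact this.symm
  have hs (k : ℕ) : Integrable (fun w : ℕ → ℝ => ∑ j ∈ Finset.range k, w j)
      (Measure.infinitePi fun _ : ℕ => F) := integrable_finsetSum _ fun i _ => hw i
  rw [compoundPoisson, integrable_map_measure (by fun_prop) hm.aemeasurable, Function.id_comp, integrable_prod_iff
    hm.aestronglyMeasurable]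
  refine ⟨ae_of_all _ fun k => hs k, ?_⟩
  have hN : Integrable (fun k : ℕ => (k : ℝ) * ∫ y, ‖y‖ ∂F) (poissonMeasure lam) := by
    refine Integrable.mul_const ?_ _
    -- Shifting the index cancels the factor `k` against `k!` and leaves the exponential series.
    rw [integrable_poissonMeasure_iff, ← summable_nat_add_iff 1]
    have := (Real.summable_pow_div_factorial (lam : ℝ)).mul_left (Real.exp (-lam) * lam)
    refine this.congr fun k => ?_
    rw [Nat.factorial_succ]
    have : (k.factorial : ℝ) ≠ 0 := by positivity
    have : ((k : ℝ) + 1) ≠ 0 := by positivity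
    rw [Real.norm_of_nonneg (by positivity)]
    push_cast
    field_simp
    ring
  refine hN.mono' .of_discrete (ae_of_all _ fun k => ?_)
  rw [Real.norm_of_nonneg (integral_nonneg fun _ => norm_nonneg _)]
  calc ∫ w : ℕ → ℝ, ‖∑ j ∈ Finset.range k, w j‖ ∂(Measure.infinitePi fun _ : ℕ => F)
    _ ≤ ∫ w : ℕ → ℝ, ∑ j ∈ Finset.range k, ‖w j‖ ∂(Measure.infinitePi fun _ : ℕ => F) :=
      integral_mono (hs k).norm (integrable_finsetSum _ fun i _ => (hw i).norm)
        fun w => norm_sum_le _ _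
    _ = k * ∫ y, ‖y‖ ∂F := by
      rw [integral_finsetSum _ fun i _ => (hw i).norm]
      simp only [hwn, Finset.sum_const, Finset.card_range, nsmul_eq_mul]

/-- Riemann--Lebesgue lemma for the characteristic function of a density. -/
lemma tendsto_charFun_withDensity_cocompact (F : Measure ℝ) [IsProbabilityMeasure F]
    (f : ℝ → ℝ) (hf_meas : Measurable f) (hf_nonneg : ∀ y, 0 ≤ f y)
    (hf_dens : F = volume.withDensity fun y => ENNReal.ofReal (f y)) :
    Tendsto (charFun F) (cocompact ℝ) (𝓝 0) := by
  have h := tendsto_integral_exp_inner_smul_cocompact (V := ℝ) (fun y => (f y : ℂ))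
  -- The Fourier kernel is `exp(-2πi⟨y, w⟩)`, so the frequency is `w = -t/(2π)`.
  have hl : Tendsto (fun t : ℝ => (-(2 * Real.pi)⁻¹) * t) (cocompact ℝ) (cocompact ℝ) := by
    rw [← Metric.cobounded_eq_cocompact]
    exact tendsto_mul_left_cobounded (by simp [Real.pi_ne_zero])
  refine (h.comp hl).congr fun t => ?_
  rw [charFun_apply_real, hf_dens, integral_withDensity_eq_integral_toReal_smul (by fun_prop)
    (ae_of_all _ fun _ => by simp)]
  refine integral_congr_ae (ae_of_all _ fun y => ?_)
  simp only [ENNReal.toReal_ofReal (hf_nonneg y), Circle.smul_def, Real.fourierChar_apply,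
    smul_eq_mul, Complex.real_smul, Real.inner_apply]
  rw [mul_comm]
  congr 2
  have : (Real.pi : ℂ) ≠ 0 := Complex.ofReal_ne_zero.2 Real.pi_ne_zero
  push_cast
  field_simp

/-- Since `|y| ≤ 1 + |y|^ρ`. The first moment serves twice: for the Lipschitz bounds on
characteristic functions, and to integrate the error of the cosine approximation. -/
lemma integrable_id_of_rpow_moment (F : Measure ℝ) [IsProbabilityMeasure F]
    (f : ℝ → ℝ) (hf_meas : Measurable f) (hf_nonneg : ∀ y, 0 ≤ f y)
    (hf_dens : F = volume.withDensity fun y => ENNReal.ofReal (f y))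
    (ρ : ℝ) (hρ : 1 ≤ ρ) (hmom : Integrable fun y : ℝ => |y| ^ ρ * f y) :
    Integrable id F := by
  have h1 : Integrable (fun y : ℝ => |y| ^ ρ) F := by
    rw [hf_dens, integrable_withDensity_iff (by fun_prop) (ae_of_all _ fun _ => by simp)]
    simpa [ENNReal.toReal_ofReal, hf_nonneg] using hmom
  refine ((integrable_const (1 : ℝ)).add h1).mono' (by fun_prop) (ae_of_all _ fun y => ?_)
  simp only [id, Real.norm_eq_abs, Pi.add_apply]
  rcases le_total |y| 1 with hy | hy
  · have : 0 ≤ |y| ^ ρ := by positivity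
    linarith
  · have := Real.self_le_rpow_of_one_le hy hρ
    linarith


/-! ### The distinguished logarithm: uniqueness, existence, measurability -/

/-- Two continuous functions on an interval around `0` with equal exponentials and equal values at
`0` agree. -/
lemma IsDistLog.eqOn {ψ L L' : ℝ → ℂ} {T : ℝ} (hT : 0 ≤ T) (hL : IsDistLog ψ T L)
    (hL' : IsDistLog ψ T L') : Set.EqOn L L' (Set.Icc (-T) T) := by
  intro t ht
  have h0 : (0 : ℝ) ∈ Set.Icc (-T) T := ⟨by linarith, hT⟩
  have hint : ∀ u ∈ Set.Icc (-T) T, ∃ k : ℤ, L u = L' u + k * (2 * Real.pi * Complex.I) :=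
    fun u hu => Complex.exp_eq_exp_iff_exists_int.1 (by rw [hL.exp_eq u hu, hL'.exp_eq u hu])
  have hpi := Real.pi_pos
  -- The imaginary part of the difference, divided by `2π`, is continuous and integer valued, hence
  -- constant on the interval; it vanishes at `0`.
  have hmaps : Set.MapsTo (fun u => (L u - L' u).im / (2 * Real.pi)) (Set.Icc (-T) T)
      (Set.range ((↑) : ℤ → ℝ)) := by
    intro u hu
    obtain ⟨k, hk⟩ := hint u hu
    refine ⟨k, ?_⟩
    have : (L u - L' u).im = k * (2 * Real.pi) := by rw [hk]; simp
    simp only [this]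
    field_simp
  have hc : ContinuousOn (fun u => (L u - L' u).im / (2 * Real.pi)) (Set.Icc (-T) T) :=
    (Complex.continuous_im.comp_continuousOn (hL.continuousOn.sub hL'.continuousOn)).div_const _
  have hdisc : IsDiscrete (Set.range ((↑) : ℤ → ℝ)) := by
    rw [← Set.image_univ]
    exact IsDiscrete.univ.image Int.isClosedEmbedding_coe_real.isInducing
  have key := isPreconnected_Icc.constant_of_mapsTo hdisc hc hmaps ht h0
  obtain ⟨k, hk⟩ := hint t ht
  simp only [hL.zero_eq, hL'.zero_eq, sub_self, Complex.zero_im, zero_div, hk] at key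
  have : (k : ℝ) = 0 := by
    have h2 : (2 : ℝ) * Real.pi ≠ 0 := by positivity
    simpa [Real.pi_ne_zero] using key
  rw [hk, Int.cast_eq_zero.1 this]
  simp

/-- Uniqueness makes the choice in the definition immaterial. One logarithm is then used for
measurability, an integral of the logarithmic derivative, and another for the linearization, a
principal logarithm. -/
lemma plugInEstimator_eq_of_isDistLog {phiW : ℝ → ℂ} {lam : ℝ} {s : ℕ → ℝ} {n : ℕ} {h : ℝ}
    (hh : 0 < h) (x d : ℝ) {L : ℝ → ℂ} (hL : IsDistLog (deconvRatio phiW lam s n h) (1 / h) L) :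
    plugInEstimator phiW lam s n h x d = (1 / (2 * Real.pi * lam)) *
      (∫ t in (-(1 / h))..(1 / h), Complex.exp (-(Complex.I * t * x)) * L t).re := by
  have H : ∃ L, IsDistLog (deconvRatio phiW lam s n h) (1 / h) L := ⟨L, hL⟩
  have hT : 0 ≤ 1 / h := by positivity
  rw [plugInEstimator, dif_pos H]
  congr 2
  refine intervalIntegral.integral_congr fun t ht => ?_
  rw [Set.uIcc_of_le (by linarith)] at ht
  simp only [H.choose_spec.eqOn hT hL ht]

lemma empCharFun_zero {s : ℕ → ℝ} {n : ℕ} (hn : n ≠ 0) : empCharFun s n 0 = 1 := by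
  have : (n : ℂ) ≠ 0 := by exact_mod_cast hn
  simp [empCharFun, this]

lemma continuous_empCharFun_comp {α : Type*} [TopologicalSpace α] {f : α → ℕ → ℝ} {g : α → ℝ}
    (hf : Continuous f) (hg : Continuous g) (n : ℕ) :
    Continuous fun a => empCharFun (f a) n (g a) := by
  unfold empCharFun
  fun_prop

lemma continuous_empCharFun (s : ℕ → ℝ) (n : ℕ) : Continuous (empCharFun s n) :=
  continuous_empCharFun_comp continuous_const continuous_id n

/-- The derivative of the empirical characteristic function. -/
noncomputable def empCharFunDeriv (s : ℕ → ℝ) (n : ℕ) (t : ℝ) : ℂ :=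
  (1 / (n : ℂ)) * ∑ j ∈ Finset.range n, Complex.exp (Complex.I * t * s j) * (Complex.I * s j)

lemma continuous_empCharFunDeriv_comp {α : Type*} [TopologicalSpace α] {f : α → ℕ → ℝ} {g : α → ℝ}
    (hf : Continuous f) (hg : Continuous g) (n : ℕ) :
    Continuous fun a => empCharFunDeriv (f a) n (g a) := by
  unfold empCharFunDeriv
  fun_prop

lemma hasDerivAt_empCharFun (s : ℕ → ℝ) (n : ℕ) (t : ℝ) :
    HasDerivAt (empCharFun s n) (empCharFunDeriv s n t) t := by
  refine HasDerivAt.const_mul _ (HasDerivAt.fun_sum fun j _ => ?_)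
  have h1 : HasDerivAt (fun u : ℝ => Complex.I * u * s j) (Complex.I * s j) t := by
    simpa using ((Complex.ofRealCLM.hasDerivAt (x := t)).const_mul Complex.I).mul_const (s j : ℂ)
  exact h1.cexp

/-- The logarithmic derivative of the empirical characteristic function. -/
noncomputable def empLogDeriv (s : ℕ → ℝ) (n : ℕ) (t : ℝ) : ℂ :=
  empCharFunDeriv s n t / empCharFun s n t

lemma measurable_empLogDeriv_comp {α : Type*} [MeasurableSpace α] {f : α → ℕ → ℝ} {g : α → ℝ}
    (hf : Measurable f) (hg : Measurable g) (n : ℕ) :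
    Measurable fun a => empLogDeriv (f a) n (g a) := by
  unfold empLogDeriv empCharFunDeriv empCharFun
  fun_prop

/-- A formula for the distinguished logarithm as an integral of the logarithmic derivative. -/
noncomputable def distLogFormula (lam : ℝ) (s : ℕ → ℝ) (n : ℕ) (t : ℝ) : ℂ :=
  lam + t ^ 2 / 2 + t * ∫ v in (0 : ℝ)..1, empLogDeriv s n (t * v)

lemma measurable_distLogFormula_uncurry (lam : ℝ) (n : ℕ) :
    Measurable fun p : (ℕ → ℝ) × ℝ => distLogFormula lam p.1 n p.2 := by
  unfold distLogFormula
  refine Measurable.add (by fun_prop) (Measurable.mul (by fun_prop) ?_)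
  simp only [intervalIntegral.integral_of_le zero_le_one]
  have hm : Measurable fun p : ((ℕ → ℝ) × ℝ) × ℝ => empLogDeriv p.1.1 n (p.1.2 * p.2) :=
    measurable_empLogDeriv_comp (by fun_prop) (by fun_prop) n
  exact (hm.stronglyMeasurable.integral_prod_right').measurable

lemma sincKernelFT_mul_of_mem_Icc {h t : ℝ} (hh : 0 < h) (ht : t ∈ Set.Icc (-(1 / h)) (1 / h)) :
    sincKernelFT (h * t) = 1 := by
  refine Set.indicator_of_mem ?_ _
  obtain ⟨h1, h2⟩ := ht
  rw [← neg_div, div_le_iff₀ hh] at h1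
  rw [le_div_iff₀ hh] at h2
  constructor <;> linarith

lemma deconvRatio_sinc_of_mem_Icc {lam : ℝ} {s : ℕ → ℝ} {n : ℕ} {h t : ℝ} (hh : 0 < h)
    (ht : t ∈ Set.Icc (-(1 / h)) (1 / h)) :
    deconvRatio sincKernelFT lam s n h t = empCharFun s n t * Complex.exp (lam + t ^ 2 / 2) := by
  rw [deconvRatio, sincKernelFT_mul_of_mem_Icc hh ht, mul_one, div_eq_mul_inv]
  congr 1
  push_cast
  rw [← Complex.exp_add, ← Complex.exp_neg]
  ring_nf

lemma deconvRatio_sinc_zero {lam : ℝ} {s : ℕ → ℝ} {n : ℕ} {h : ℝ} (hh : 0 < h) (hn : n ≠ 0) :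
    Complex.log (deconvRatio sincKernelFT lam s n h 0) = lam := by
  have hT : 0 ≤ 1 / h := by positivity
  rw [deconvRatio_sinc_of_mem_Icc hh ⟨by linarith, hT⟩, empCharFun_zero hn]
  simp only [one_mul, Complex.ofReal_zero, ne_eq, OfNat.ofNat_ne_zero, not_false_eq_true, zero_pow,
    zero_div, add_zero]
  rw [← Complex.ofReal_exp, ← Complex.ofReal_log (Real.exp_pos _).le, Real.log_exp]

/-- The product of the empirical characteristic function with the exponential of minus the integral
of its logarithmic derivative has derivative zero and equals `1` at the origin. -/
lemma isDistLog_distLogFormula {lam : ℝ} {s : ℕ → ℝ} {n : ℕ} {h : ℝ} (hh : 0 < h)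
    (hne : ∀ t ∈ Set.Icc (-(1 / h)) (1 / h), empCharFun s n t ≠ 0) :
    IsDistLog (deconvRatio sincKernelFT lam s n h) (1 / h) (distLogFormula lam s n) := by
  set T := 1 / h with hTdef
  have hT : 0 ≤ T := by positivity
  have h0 : (0 : ℝ) ∈ Set.Icc (-T) T := ⟨by linarith, hT⟩
  -- For `n = 0` the empirical characteristic function is identically `0`, because the empty sum is.
  have hn : n ≠ 0 := by
    rintro rfl
    exact hne 0 h0 (by simp [empCharFun])
  have hq (t : ℝ) (ht : t ∈ Set.Icc (-T) T) : ContinuousAt (empLogDeriv s n) t :=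
    (continuous_empCharFunDeriv_comp continuous_const continuous_id n).continuousAt.div
      (continuous_empCharFun s n).continuousAt (hne t ht)
  have hqm : Measurable (empLogDeriv s n) :=
    measurable_empLogDeriv_comp measurable_const measurable_id n
  have hI (t : ℝ) (ht : t ∈ Set.Icc (-T) T) :
      HasDerivAt (fun u => ∫ v in (0 : ℝ)..u, empLogDeriv s n v) (empLogDeriv s n t) t := by
    refine intervalIntegral.integral_hasDerivAt_right (ContinuousOn.intervalIntegrable
      fun u hu => (hq u (Set.uIcc_subset_Icc h0 ht hu)).continuousWithinAt)
      (hqm.stronglyMeasurable.stronglyMeasurableAtFilter) (hq t ht)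
  -- Substituting `v ↦ t v` gives an integral from `0` to `t`, which can be differentiated; the
  -- fixed limits of the definition are what give joint measurability in data and `t`.
  have hform : distLogFormula lam s n =
      fun t : ℝ => (lam : ℂ) + (t : ℂ) ^ 2 / 2 + ∫ v in (0 : ℝ)..t, empLogDeriv s n v := by
    funext t
    have := intervalIntegral.smul_integral_comp_mul_left (a := 0) (b := 1) (empLogDeriv s n) t
    rw [mul_zero, mul_one, Complex.real_smul] at this
    rw [distLogFormula, this]
  have hexp : ∀ t ∈ Set.Icc (-T) T,
      empCharFun s n t * Complex.exp (-∫ v in (0 : ℝ)..t, empLogDeriv s n v) = 1 := by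
    have hd (t : ℝ) (ht : t ∈ Set.Icc (-T) T) : HasDerivAt (fun t =>
        empCharFun s n t * Complex.exp (-∫ v in (0 : ℝ)..t, empLogDeriv s n v)) 0 t := by
      have := (hasDerivAt_empCharFun s n t).mul (hI t ht).neg.cexp
      convert! this using 1
      rw [empLogDeriv]
      field_simp [hne t ht]
      ring
    have hc := constant_of_has_deriv_right_zero
      (fun t ht => (hd t ht).continuousAt.continuousWithinAt)
      (fun t ht => (hd t ⟨ht.1, ht.2.le⟩).hasDerivWithinAt)
    intro t ht
    rw [hc t ht, ← hc 0 h0]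
    simp [empCharFun_zero hn]
  refine ⟨?_, fun t ht => ?_, ?_⟩
  · rw [hform]
    exact fun t ht => (ContinuousAt.add (by fun_prop) (hI t ht).continuousAt).continuousWithinAt
  · rw [deconvRatio_sinc_of_mem_Icc hh ht, hform, Complex.exp_add, mul_comm]
    congr 1
    have := hexp t ht
    rw [Complex.exp_neg, mul_inv_eq_one₀ (Complex.exp_ne_zero _)] at this
    exact this.symm
  · rw [deconvRatio_sinc_zero hh hn]
    simp [distLogFormula]

lemma exists_isDistLog_iff {lam : ℝ} {s : ℕ → ℝ} {n : ℕ} {h : ℝ} (hh : 0 < h) :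
    (∃ L, IsDistLog (deconvRatio sincKernelFT lam s n h) (1 / h) L) ↔
      ∀ t ∈ Set.Icc (-(1 / h)) (1 / h), empCharFun s n t ≠ 0 := by
  refine ⟨fun ⟨L, hL⟩ t ht h0 => ?_, fun hne => ⟨_, isDistLog_distLogFormula hh hne⟩⟩
  have := hL.exp_eq t ht
  rw [deconvRatio_sinc_of_mem_Icc hh ht, h0, zero_mul] at this
  exact Complex.exp_ne_zero _ this

/-- The complement is the projection of a closed set along a compact interval, hence closed. -/
lemma measurableSet_forall_empCharFun_ne_zero (n : ℕ) (T : ℝ) :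
    MeasurableSet {s : ℕ → ℝ | ∀ t ∈ Set.Icc (-T) T, empCharFun s n t ≠ 0} := by
  have hcl : IsClosed {p : (ℕ → ℝ) × Set.Icc (-T) T | empCharFun p.1 n p.2 = 0} :=
    isClosed_eq (continuous_empCharFun_comp continuous_fst (by fun_prop) n) continuous_const
  have := (isClosedMap_fst_of_compactSpace _ hcl).isOpen_compl.measurableSet
  convert! this using 1
  ext s
  simp

/-- The plug-in estimator is a measurable function of the data. -/
lemma measurable_plugInEstimator {Ω : Type*} [MeasurableSpace Ω] {X : ℕ → Ω → ℝ} {d : Ω → ℝ}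
    (hX : ∀ i, Measurable (X i)) (hd : Measurable d) (lam : ℝ) (n : ℕ) {h : ℝ} (hh : 0 < h)
    (x : ℝ) : Measurable fun ω =>
      plugInEstimator sincKernelFT lam (fun i => X i ω) n h x (d ω) := by
  classical
  set T := 1 / h with hTdef
  have hT : -T ≤ T := by
    have : 0 ≤ T := by positivity
    linarith
  let A : (ℕ → ℝ) → ℝ := fun s => (1 / (2 * Real.pi * lam)) *
      (∫ t in (-T)..T, Complex.exp (-(Complex.I * t * x)) * distLogFormula lam s n t).re
  have hA : Measurable A := by
    refine Measurable.const_mul (Complex.measurable_re.comp ?_) _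
    simp only [intervalIntegral.integral_of_le hT]
    have hm : Measurable fun p : (ℕ → ℝ) × ℝ =>
        Complex.exp (-(Complex.I * p.2 * x)) * distLogFormula lam p.1 n p.2 :=
      Measurable.mul (by fun_prop) (measurable_distLogFormula_uncurry lam n)
    exact (hm.stronglyMeasurable.integral_prod_right').measurable
  have hXm : Measurable fun ω i => X i ω := measurable_pi_lambda _ hX
  have : (fun ω => plugInEstimator sincKernelFT lam (fun i => X i ω) n h x (d ω)) =
      fun ω => if ω ∈ (fun ω i => X i ω) ⁻¹'
        {s : ℕ → ℝ | ∀ t ∈ Set.Icc (-T) T, empCharFun s n t ≠ 0}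
      then A (fun i => X i ω) else d ω := by
    funext ω
    split_ifs with hω
    · exact plugInEstimator_eq_of_isDistLog hh x _ (isDistLog_distLogFormula hh hω)
    · rw [plugInEstimator, dif_neg]
      rwa [exists_isDistLog_iff hh]
  rw [this]
  exact Measurable.ite (hXm (measurableSet_forall_empCharFun_ne_zero n T)) (hA.comp hXm) hd


/-! ### Concentration of the edge weight near the endpoints -/

/-- The weight `t ↦ T exp (-T²/2) exp (t²/2)`, which on `[0, T]` concentrates near `T`. -/
noncomputable def edgeWeight (T t : ℝ) : ℝ := T * Real.exp (-T ^ 2 / 2) * Real.exp (t ^ 2 / 2)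

@[fun_prop]
lemma continuous_edgeWeight (T : ℝ) : Continuous (edgeWeight T) := by
  unfold edgeWeight
  fun_prop

lemma edgeWeight_nonneg {T : ℝ} (hT : 0 ≤ T) (t : ℝ) : 0 ≤ edgeWeight T t := by
  unfold edgeWeight
  positivity

lemma edgeWeight_neg (T t : ℝ) : edgeWeight T (-t) = edgeWeight T t := by
  simp [edgeWeight]

lemma integral_symm_of_even {g : ℝ → ℝ} (hg : Continuous g) (heven : ∀ t, g (-t) = g t) (T : ℝ) :
    ∫ t in (-T)..T, g t = 2 * ∫ t in (0 : ℝ)..T, g t := by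
  rw [← intervalIntegral.integral_add_adjacent_intervals (hg.intervalIntegrable (-T) 0)
    (hg.intervalIntegrable 0 T)]
  have : ∫ t in (-T)..0, g t = ∫ t in (0 : ℝ)..T, g t := by
    have := intervalIntegral.integral_comp_neg (a := 0) (b := T) g
    simp only [heven, neg_zero] at this
    exact this.symm
  rw [this]
  ring

/-- On `[0, T]` one has `T² - t² ≥ T(T - t)`, so the weight is at most `T exp(-T(T - t)/2)`. Half of
this exponential absorbs the factor `T(T - t)` through `u e^{-u} ≤ 1`; the other half is integrated.
-/
lemma integral_sub_mul_edgeWeight_le {T : ℝ} (hT : 0 < T) :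
    ∫ t in (0 : ℝ)..T, (T - t) * edgeWeight T t ≤ 16 / T := by
  have hpt : ∀ t ∈ Set.Icc 0 T, (T - t) * edgeWeight T t ≤
      4 * Real.exp (-(T * (T - t) / 4)) := by
    rintro t ⟨ht0, htT⟩
    have h1 : Real.exp (-T ^ 2 / 2) * Real.exp (t ^ 2 / 2) ≤
        Real.exp (-(T * (T - t) / 4)) * Real.exp (-(T * (T - t) / 4)) := by
      rw [← Real.exp_add, ← Real.exp_add]
      refine Real.exp_le_exp.2 ?_
      nlinarith [mul_nonneg ht0 (sub_nonneg.2 htT)]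
    have h2 : T * (T - t) / 4 * Real.exp (-(T * (T - t) / 4)) ≤ 1 := by
      rw [Real.exp_neg, ← div_eq_mul_inv, div_le_one (Real.exp_pos _)]
      linarith [Real.add_one_le_exp (T * (T - t) / 4)]
    have h3 : 0 ≤ T * (T - t) := mul_nonneg hT.le (sub_nonneg.2 htT)
    calc (T - t) * edgeWeight T t
        = T * (T - t) * (Real.exp (-T ^ 2 / 2) * Real.exp (t ^ 2 / 2)) := by
          unfold edgeWeight; ring
      _ ≤ T * (T - t) * (Real.exp (-(T * (T - t) / 4)) * Real.exp (-(T * (T - t) / 4))) := by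
          gcongr
      _ = 4 * Real.exp (-(T * (T - t) / 4)) *
          (T * (T - t) / 4 * Real.exp (-(T * (T - t) / 4))) := by ring
      _ ≤ 4 * Real.exp (-(T * (T - t) / 4)) * 1 := by gcongr
      _ = _ := mul_one _
  have hd : ∀ t ∈ Set.uIcc 0 T, HasDerivAt (fun t => 16 / T * Real.exp (-(T * (T - t) / 4)))
      (4 * Real.exp (-(T * (T - t) / 4))) t := by
    intro t _
    have h1 : HasDerivAt (fun t => -(T * (T - t) / 4)) (T / 4) t := by
      have := ((((hasDerivAt_id t).const_sub T).const_mul T).div_const 4).neg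
      convert! this using 1
      ring
    have := h1.exp.const_mul (16 / T)
    convert! this using 1
    field_simp
    ring
  calc ∫ t in (0 : ℝ)..T, (T - t) * edgeWeight T t
      ≤ ∫ t in (0 : ℝ)..T, 4 * Real.exp (-(T * (T - t) / 4)) :=
        intervalIntegral.integral_mono_on hT.le (Continuous.intervalIntegrable (by fun_prop) _ _)
          (Continuous.intervalIntegrable (by fun_prop) _ _) hpt
    _ = 16 / T * Real.exp (-(T * (T - T) / 4)) - 16 / T * Real.exp (-(T * (T - 0) / 4)) :=
        intervalIntegral.integral_eq_sub_of_hasDerivAt hd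
          (Continuous.intervalIntegrable (by fun_prop) _ _)
    _ ≤ 16 / T := by
        have : 0 ≤ 16 / T * Real.exp (-(T * (T - 0) / 4)) := by positivity
        simp only [sub_self, mul_zero, zero_div, neg_zero, Real.exp_zero, mul_one]
        linarith

lemma integral_mul_exp_sq_half (T : ℝ) :
    ∫ t in (0 : ℝ)..T, t * Real.exp (t ^ 2 / 2) = Real.exp (T ^ 2 / 2) - 1 := by
  have hd : ∀ t ∈ Set.uIcc 0 T, HasDerivAt (fun t => Real.exp (t ^ 2 / 2))
      (t * Real.exp (t ^ 2 / 2)) t := by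
    intro t _
    have := (((hasDerivAt_id t).pow 2).div_const 2).exp
    convert! this using 1
    simp
    ring
  rw [intervalIntegral.integral_eq_sub_of_hasDerivAt hd
    (Continuous.intervalIntegrable (by fun_prop) _ _)]
  simp

/-- Split `T = (T - t) + t` under the integral: the first part is the distance moment bounded above,
and the second is explicit because `t exp(t²/2)` has an elementary antiderivative. -/
lemma abs_integral_edgeWeight_sub_one_le {T : ℝ} (hT : 0 < T) :
    |(∫ t in (0 : ℝ)..T, edgeWeight T t) - 1| ≤ Real.exp (-T ^ 2 / 2) + 16 / T ^ 2 := by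
  have h1 : T * (∫ t in (0 : ℝ)..T, edgeWeight T t) =
      (∫ t in (0 : ℝ)..T, (T - t) * edgeWeight T t) + T * (1 - Real.exp (-T ^ 2 / 2)) := by
    have h2 : T * (1 - Real.exp (-T ^ 2 / 2)) = ∫ t in (0 : ℝ)..T, t * edgeWeight T t := by
      have : (fun t => t * edgeWeight T t) =
          fun t => T * Real.exp (-T ^ 2 / 2) * (t * Real.exp (t ^ 2 / 2)) := by
        funext t; unfold edgeWeight; ring
      rw [this, intervalIntegral.integral_const_mul, integral_mul_exp_sq_half]
      have : Real.exp (-T ^ 2 / 2) * Real.exp (T ^ 2 / 2) = 1 := by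
        rw [← Real.exp_add]; ring_nf; exact Real.exp_zero
      linear_combination (-T) * this
    rw [h2, ← intervalIntegral.integral_add (Continuous.intervalIntegrable (by fun_prop) _ _)
      (Continuous.intervalIntegrable (by fun_prop) _ _), ← intervalIntegral.integral_const_mul]
    congr 1
    funext t
    ring
  have h3 := integral_sub_mul_edgeWeight_le hT
  have h4 : 0 ≤ ∫ t in (0 : ℝ)..T, (T - t) * edgeWeight T t :=
    intervalIntegral.integral_nonneg hT.le fun t ht =>
      mul_nonneg (sub_nonneg.2 ht.2) (edgeWeight_nonneg hT.le t)
  set D := ∫ t in (0 : ℝ)..T, (T - t) * edgeWeight T t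
  have h5 : (∫ t in (0 : ℝ)..T, edgeWeight T t) - 1 = D / T - Real.exp (-T ^ 2 / 2) := by
    rw [eq_sub_iff_add_eq, eq_div_iff hT.ne']
    linear_combination h1
  have h6 : D / T ≤ 16 / T ^ 2 := by
    rw [pow_two, ← div_div]
    gcongr
  have h7 : 0 ≤ D / T := by positivity
  have h8 := Real.exp_pos (-T ^ 2 / 2)
  rw [h5, abs_le]
  constructor <;> linarith

lemma tendsto_pow_mul_exp_neg_sq_half (k : ℕ) :
    Tendsto (fun T : ℝ => T ^ k * Real.exp (-T ^ 2 / 2)) atTop (𝓝 0) := by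
  refine squeeze_zero' (g := fun T : ℝ => T ^ k * Real.exp (-T)) ?_ ?_
    (Real.tendsto_pow_mul_exp_neg_atTop_nhds_zero k)
  · filter_upwards [eventually_ge_atTop 0] with T hT
    positivity
  · filter_upwards [eventually_ge_atTop 2] with T hT
    have : -T ^ 2 / 2 ≤ -T := by nlinarith
    gcongr

lemma tendsto_integral_edgeWeight :
    Tendsto (fun T => ∫ t in (0 : ℝ)..T, edgeWeight T t) atTop (𝓝 1) := by
  rw [tendsto_iff_norm_sub_tendsto_zero]
  have hlim : Tendsto (fun T : ℝ => Real.exp (-T ^ 2 / 2) + 16 / T ^ 2) atTop (𝓝 (0 + 0)) := by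
    refine Tendsto.add (by simpa using tendsto_pow_mul_exp_neg_sq_half 0) ?_
    exact tendsto_const_nhds.div_atTop (tendsto_pow_atTop two_ne_zero)
  rw [add_zero] at hlim
  refine squeeze_zero' (Eventually.of_forall fun _ => norm_nonneg _) ?_ hlim
  filter_upwards [eventually_gt_atTop 0] with T hT
  exact abs_integral_edgeWeight_sub_one_le hT

/-- Averages against the edge weight of a bounded function vanishing at infinity tend to `0`. -/
lemma tendsto_integral_edgeWeight_mul {g : ℝ → ℝ} (hg : Continuous g) (hg0 : ∀ t, 0 ≤ g t) {K : ℝ}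
    (hK : ∀ t, g t ≤ K) (hlim : Tendsto g (cocompact ℝ) (𝓝 0)) :
    Tendsto (fun T => ∫ t in (-T)..T, edgeWeight T t * g t) atTop (𝓝 0) := by
  rw [Metric.tendsto_atTop']
  intro ε hε
  have hK0 : 0 ≤ K := (hg0 0).trans (hK 0)
  obtain ⟨A, hA⟩ : ∃ A, ∀ t, A ≤ |t| → g t < ε / 8 := by
    have := hlim.eventually (eventually_lt_nhds (by positivity : 0 < ε / 8))
    rw [← Metric.cobounded_eq_cocompact, hasBasis_cobounded_norm.eventually_iff] at this
    obtain ⟨A, -, hA⟩ := this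
    exact ⟨A, fun t ht => hA ht⟩
  have h1 : Tendsto (fun T : ℝ => ε / 8 * (2 * ∫ t in (0 : ℝ)..T, edgeWeight T t) +
      2 * K * Real.exp (A ^ 2 / 2) * (T ^ 2 * Real.exp (-T ^ 2 / 2))) atTop
      (𝓝 (ε / 8 * (2 * 1) + 2 * K * Real.exp (A ^ 2 / 2) * 0)) :=
    ((tendsto_integral_edgeWeight.const_mul 2).const_mul _).add
      ((tendsto_pow_mul_exp_neg_sq_half 2).const_mul _)
  have h2 := h1.eventually (eventually_lt_nhds (by linarith :
    ε / 8 * (2 * 1) + 2 * K * Real.exp (A ^ 2 / 2) * 0 < ε))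
  obtain ⟨T₀, hT₀⟩ := eventually_atTop.1 (h2.and (eventually_gt_atTop 0))
  refine ⟨T₀, fun T hT => ?_⟩
  obtain ⟨hlt, hT0⟩ := hT₀ T hT.le
  have hnn : 0 ≤ ∫ t in (-T)..T, edgeWeight T t * g t :=
    intervalIntegral.integral_nonneg (by linarith) fun t _ =>
      mul_nonneg (edgeWeight_nonneg hT0.le t) (hg0 t)
  rw [Real.dist_eq, sub_zero, abs_of_nonneg hnn]
  refine lt_of_le_of_lt ?_ hlt
  calc ∫ t in (-T)..T, edgeWeight T t * g t
      ≤ ∫ t in (-T)..T, (ε / 8 * edgeWeight T t + K * edgeWeight T A) := by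
        refine intervalIntegral.integral_mono_on (by linarith)
          (Continuous.intervalIntegrable (by fun_prop) _ _)
          (Continuous.intervalIntegrable (by fun_prop) _ _) fun t _ => ?_
        have hw := edgeWeight_nonneg hT0.le t
        have hwA := edgeWeight_nonneg hT0.le A
        -- Far from the origin `g` is small. Near it the weight is at most its value at `A`, which
        -- over an interval of length `2T` costs a multiple of `T² exp(-T²/2)`.
        rcases le_total A |t| with h | h
        · have := mul_le_mul_of_nonneg_left (hA t h).le hw
          have := mul_nonneg hK0 hwA
          linarith
        · have h3 : edgeWeight T t ≤ edgeWeight T A := by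
            unfold edgeWeight
            have : t ^ 2 ≤ A ^ 2 := sq_le_sq' (neg_le_of_abs_le h) (le_of_abs_le h)
            gcongr
          have := mul_le_mul h3 (hK t) (hg0 t) hwA
          have : 0 ≤ ε / 8 * edgeWeight T t := by positivity
          linarith
    _ = ε / 8 * (2 * ∫ t in (0 : ℝ)..T, edgeWeight T t) +
        2 * K * Real.exp (A ^ 2 / 2) * (T ^ 2 * Real.exp (-T ^ 2 / 2)) := by
        rw [intervalIntegral.integral_add (Continuous.intervalIntegrable (by fun_prop) _ _)
          (Continuous.intervalIntegrable (by fun_prop) _ _), intervalIntegral.integral_const_mul,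
          integral_symm_of_even (continuous_edgeWeight T) (edgeWeight_neg T),
          intervalIntegral.integral_const, smul_eq_mul, edgeWeight]
        ring

/-- As a function of `t` the cosine is `|z|`-Lipschitz. Replacing it by its value at `T` costs `|z|`
times the mean distance to `T`, plus the defect of the total mass from `1`. -/
lemma abs_integral_edgeWeight_mul_cos_sub_le {T : ℝ} (hT : 0 < T) (z : ℝ) :
    |(∫ t in (0 : ℝ)..T, edgeWeight T t * Real.cos (t * z)) - Real.cos (T * z)| ≤
      16 / T * |z| + |(∫ t in (0 : ℝ)..T, edgeWeight T t) - 1| := by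
  have h1 : (∫ t in (0 : ℝ)..T, edgeWeight T t * Real.cos (t * z)) - Real.cos (T * z) =
      (∫ t in (0 : ℝ)..T, edgeWeight T t * (Real.cos (t * z) - Real.cos (T * z))) +
        ((∫ t in (0 : ℝ)..T, edgeWeight T t) - 1) * Real.cos (T * z) := by
    simp only [mul_sub]
    rw [intervalIntegral.integral_sub (Continuous.intervalIntegrable (by fun_prop) _ _)
      (Continuous.intervalIntegrable (by fun_prop) _ _), intervalIntegral.integral_mul_const]
    ring
  have h2 : |∫ t in (0 : ℝ)..T, edgeWeight T t * (Real.cos (t * z) - Real.cos (T * z))| ≤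
      16 / T * |z| := by
    calc |∫ t in (0 : ℝ)..T, edgeWeight T t * (Real.cos (t * z) - Real.cos (T * z))|
        ≤ ∫ t in (0 : ℝ)..T, |edgeWeight T t * (Real.cos (t * z) - Real.cos (T * z))| :=
          intervalIntegral.abs_integral_le_integral_abs hT.le
      _ ≤ ∫ t in (0 : ℝ)..T, (T - t) * edgeWeight T t * |z| := by
          refine intervalIntegral.integral_mono_on hT.le
            (Continuous.intervalIntegrable (by fun_prop) _ _)
            (Continuous.intervalIntegrable (by fun_prop) _ _) fun t ht => ?_
          have hc : |Real.cos (t * z) - Real.cos (T * z)| ≤ (T - t) * |z| := by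
            refine (Real.abs_cos_sub_cos_le _ _).trans ?_
            rw [← sub_mul, abs_mul, abs_sub_comm, abs_of_nonneg (sub_nonneg.2 ht.2)]
          rw [abs_mul, abs_of_nonneg (edgeWeight_nonneg hT.le t)]
          calc edgeWeight T t * |Real.cos (t * z) - Real.cos (T * z)|
              ≤ edgeWeight T t * ((T - t) * |z|) :=
                mul_le_mul_of_nonneg_left hc (edgeWeight_nonneg hT.le t)
            _ = _ := by ring
      _ = (∫ t in (0 : ℝ)..T, (T - t) * edgeWeight T t) * |z| :=
          intervalIntegral.integral_mul_const _ _
      _ ≤ 16 / T * |z| := by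
          gcongr
          exact integral_sub_mul_edgeWeight_le hT
  rw [h1]
  refine (abs_add_le _ _).trans (add_le_add h2 ?_)
  rw [abs_mul]
  exact mul_le_of_le_one_right (abs_nonneg _) (Real.abs_cos_le_one _)

/-! ### The linearized summand and its cosine approximation -/

/-- The reciprocal of the characteristic function `exp (-λ + λ φ(t)) exp (-t²/2)`. -/
noncomputable def invMixCF (lam : ℝ) (φ : ℝ → ℂ) (t : ℝ) : ℂ :=
  Complex.exp (lam + t ^ 2 / 2 - lam * φ t)

lemma norm_invMixCF_le {lam : ℝ} (hlam : 0 ≤ lam) {φ : ℝ → ℂ} {t : ℝ} (hφ : ‖φ t‖ ≤ 1) :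
    ‖invMixCF lam φ t‖ ≤ Real.exp (2 * lam) * Real.exp (t ^ 2 / 2) := by
  rw [invMixCF, Complex.norm_exp, ← Real.exp_add]
  refine Real.exp_le_exp.2 ?_
  have h1 : (lam + (t : ℂ) ^ 2 / 2 - lam * φ t).re = lam + t ^ 2 / 2 - lam * (φ t).re := by
    have : ((lam : ℂ) + (t : ℂ) ^ 2 / 2) = ((lam + t ^ 2 / 2 : ℝ) : ℂ) := by push_cast; ring
    rw [Complex.sub_re, this, Complex.ofReal_re, Complex.re_ofReal_mul]
  have h2 : -1 ≤ (φ t).re := (abs_le.1 ((Complex.abs_re_le_norm _).trans hφ)).1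
  rw [h1]
  nlinarith

@[fun_prop]
lemma continuous_invMixCF (lam : ℝ) {φ : ℝ → ℂ} (hφ : Continuous φ) :
    Continuous (invMixCF lam φ) := by
  unfold invMixCF
  fun_prop

/-- The contribution of one observation to the linearized estimator. -/
noncomputable def linStat (lam : ℝ) (φ : ℝ → ℂ) (x T y : ℝ) : ℝ :=
  (1 / (2 * Real.pi * lam)) *
    (∫ t in (-T)..T, Complex.exp (Complex.I * t * (y - x)) * invMixCF lam φ t).re

/-- The contribution of one observation, rescaled by `T exp (-T²/2)`. -/
noncomputable def scaledStat (lam : ℝ) (φ : ℝ → ℂ) (x T y : ℝ) : ℝ :=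
  T * Real.exp (-T ^ 2 / 2) * linStat lam φ x T y

lemma abs_scaledStat_le {lam : ℝ} (hlam : 0 < lam) {φ : ℝ → ℂ}
    (hφ : ∀ t, ‖φ t‖ ≤ 1) (x y : ℝ) {T : ℝ} (hT : 0 ≤ T) :
    |scaledStat lam φ x T y| ≤
      Real.exp (2 * lam) / (Real.pi * lam) * ∫ t in (0 : ℝ)..T, edgeWeight T t := by
  have hpi := Real.pi_pos
  have h1 : ‖∫ t in (-T)..T, Complex.exp (Complex.I * t * (y - x)) * invMixCF lam φ t‖ ≤
      ∫ t in (-T)..T, Real.exp (2 * lam) * Real.exp (t ^ 2 / 2) := by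
    refine intervalIntegral.norm_integral_le_of_norm_le (by linarith)
      (ae_of_all _ fun t _ => ?_) (Continuous.intervalIntegrable (by fun_prop) _ _)
    rw [norm_mul, show Complex.I * t * (y - x) = ((t * (y - x) : ℝ) : ℂ) * Complex.I by
      push_cast; ring, Complex.norm_exp_ofReal_mul_I, one_mul]
    exact norm_invMixCF_le hlam.le (hφ t)
  have h2 : T * Real.exp (-T ^ 2 / 2) * (∫ t in (-T)..T, Real.exp (2 * lam) * Real.exp (t ^ 2 / 2))
      = 2 * Real.exp (2 * lam) * ∫ t in (0 : ℝ)..T, edgeWeight T t := by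
    rw [mul_assoc 2, mul_left_comm 2, ← integral_symm_of_even (continuous_edgeWeight T)
      (edgeWeight_neg T), intervalIntegral.integral_const_mul, mul_left_comm]
    congr 1
    rw [← intervalIntegral.integral_const_mul]
    rfl
  calc |scaledStat lam φ x T y| = T * Real.exp (-T ^ 2 / 2) * ((1 / (2 * Real.pi * lam)) *
        |(∫ t in (-T)..T, Complex.exp (Complex.I * t * (y - x)) * invMixCF lam φ t).re|) := by
        rw [scaledStat, linStat, abs_mul, abs_mul (1 / (2 * Real.pi * lam)),
          abs_of_nonneg (by positivity : 0 ≤ T * Real.exp (-T ^ 2 / 2)),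
          abs_of_nonneg (by positivity : 0 ≤ 1 / (2 * Real.pi * lam))]
    _ ≤ T * Real.exp (-T ^ 2 / 2) * ((1 / (2 * Real.pi * lam)) *
        ∫ t in (-T)..T, Real.exp (2 * lam) * Real.exp (t ^ 2 / 2)) := by
        gcongr
        exact (Complex.abs_re_le_norm _).trans h1
    _ = (1 / (2 * Real.pi * lam)) * (T * Real.exp (-T ^ 2 / 2) *
        ∫ t in (-T)..T, Real.exp (2 * lam) * Real.exp (t ^ 2 / 2)) := by ring
    _ = _ := by
        rw [h2]
        field_simp

/-- Factor the reciprocal as `e^λ exp(t²/2) (1 + (exp(-λφ) - 1))`. The term `1` gives the cosine,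
with the two endpoints turning `1/(2πλ)` into `1/(πλ)`; the other term is an edge average of a
function vanishing at infinity. -/
lemma abs_scaledStat_sub_cos_le {lam : ℝ} (hlam : 0 < lam) {φ : ℝ → ℂ} (hφc : Continuous φ)
    (x y : ℝ) {T : ℝ} (hT : 0 < T) :
    |scaledStat lam φ x T y - Real.exp lam / (Real.pi * lam) * Real.cos (T * (y - x))| ≤
      Real.exp lam / (Real.pi * lam) *
        ((∫ t in (-T)..T, edgeWeight T t * ‖Complex.exp (-(lam * φ t)) - 1‖) +
          |(∫ t in (0 : ℝ)..T, edgeWeight T t) - 1| + 16 / T * |y - x|) := by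
  have hpi := Real.pi_pos
  set z := y - x with hz
  set corr := ∫ t in (-T)..T, (edgeWeight T t : ℂ) *
    (Complex.exp (Complex.I * t * z) * (Complex.exp (-(lam * φ t)) - 1)) with hcorr
  have hnorm : ‖corr‖ ≤ ∫ t in (-T)..T, edgeWeight T t * ‖Complex.exp (-(lam * φ t)) - 1‖ := by
    refine intervalIntegral.norm_integral_le_of_norm_le (by linarith)
      (ae_of_all _ fun t _ => ?_) (Continuous.intervalIntegrable (by fun_prop) _ _)
    rw [norm_mul, norm_mul, show Complex.I * t * z = ((t * z : ℝ) : ℂ) * Complex.I by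
      push_cast; ring, Complex.norm_exp_ofReal_mul_I, one_mul, Complex.norm_real,
      Real.norm_of_nonneg (edgeWeight_nonneg hT.le t)]
  have hmain : (∫ t in (-T)..T, (edgeWeight T t : ℂ) * Complex.exp (Complex.I * t * z)).re =
      2 * ∫ t in (0 : ℝ)..T, edgeWeight T t * Real.cos (t * z) := by
    rw [← integral_symm_of_even (g := fun t => edgeWeight T t * Real.cos (t * z)) (by fun_prop)
      (fun t => by rw [edgeWeight_neg, neg_mul, Real.cos_neg])]
    have := Complex.reCLM.intervalIntegral_comp_comm (μ := volume) (a := -T) (b := T)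
      (f := fun t : ℝ => (edgeWeight T t : ℂ) * Complex.exp (Complex.I * t * z))
      (Continuous.intervalIntegrable (by fun_prop) _ _)
    simp only [Complex.reCLM_apply] at this
    rw [← this]
    congr 1
    funext t
    rw [Complex.re_ofReal_mul, show Complex.I * t * z = ((t * z : ℝ) : ℂ) * Complex.I by
      push_cast; ring, Complex.exp_ofReal_mul_I_re]
  have hsplit : ((T * Real.exp (-T ^ 2 / 2) : ℝ) : ℂ) *
      (∫ t in (-T)..T, Complex.exp (Complex.I * t * (y - x)) * invMixCF lam φ t) =
      (Real.exp lam : ℂ) *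
        ((∫ t in (-T)..T, (edgeWeight T t : ℂ) * Complex.exp (Complex.I * t * z)) + corr) := by
    rw [hcorr, ← intervalIntegral.integral_add (Continuous.intervalIntegrable (by fun_prop) _ _)
      (Continuous.intervalIntegrable (by fun_prop) _ _), ← intervalIntegral.integral_const_mul,
      ← intervalIntegral.integral_const_mul]
    congr 1
    funext t
    have : invMixCF lam φ t = (Real.exp lam : ℂ) * (Real.exp (t ^ 2 / 2) : ℂ) *
        Complex.exp (-(lam * φ t)) := by
      rw [invMixCF]
      push_cast
      rw [← Complex.exp_add, ← Complex.exp_add]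
      ring_nf
    rw [this, edgeWeight, hz]
    push_cast
    ring
  have hre : scaledStat lam φ x T y = (1 / (2 * Real.pi * lam)) * (Real.exp lam *
      (2 * (∫ t in (0 : ℝ)..T, edgeWeight T t * Real.cos (t * z)) + corr.re)) := by
    have := congrArg Complex.re hsplit
    rw [Complex.re_ofReal_mul, Complex.re_ofReal_mul, Complex.add_re, hmain] at this
    rw [← this, scaledStat, linStat]
    ring
  have hc := abs_integral_edgeWeight_mul_cos_sub_le hT z
  have hcr := (Complex.abs_re_le_norm corr).trans hnorm
  have hcr0 : |corr.re / 2| ≤ |corr.re| := by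
    rw [abs_div, abs_two]
    linarith [abs_nonneg corr.re]
  have hfin : scaledStat lam φ x T y - Real.exp lam / (Real.pi * lam) * Real.cos (T * z) =
      Real.exp lam / (Real.pi * lam) * (((∫ t in (0 : ℝ)..T, edgeWeight T t * Real.cos (t * z)) -
        Real.cos (T * z)) + corr.re / 2) := by
    rw [hre]
    generalize (∫ t in (0 : ℝ)..T, edgeWeight T t * Real.cos (t * z)) = J
    field_simp
    ring
  rw [hfin, abs_mul, abs_of_nonneg (by positivity)]
  gcongr
  refine (abs_add_le _ _).trans ?_
  linarith

lemma tendsto_integral_edgeWeight_mul_norm_exp_sub_one {lam : ℝ} (hlam : 0 ≤ lam) {φ : ℝ → ℂ}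
    (hφc : Continuous φ) (hφ : ∀ t, ‖φ t‖ ≤ 1) (hlim : Tendsto φ (cocompact ℝ) (𝓝 0)) :
    Tendsto (fun T => ∫ t in (-T)..T, edgeWeight T t * ‖Complex.exp (-(lam * φ t)) - 1‖) atTop
      (𝓝 0) := by
  refine tendsto_integral_edgeWeight_mul (by fun_prop) (fun _ => norm_nonneg _)
    (K := Real.exp lam + 1) (fun t => ?_) ?_
  · refine (norm_sub_le _ _).trans ?_
    rw [norm_one]
    gcongr
    refine (Complex.norm_exp_le_exp_norm _).trans (Real.exp_le_exp.2 ?_)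
    rw [norm_neg, norm_mul, Complex.norm_real, Real.norm_of_nonneg hlam]
    exact mul_le_of_le_one_right hlam (hφ t)
  · have hc : Continuous fun u : ℂ => ‖Complex.exp (-(lam * u)) - 1‖ := by fun_prop
    have := (hc.tendsto 0).comp hlim
    simp only [mul_zero, neg_zero, Complex.exp_zero, sub_self, norm_zero] at this
    exact this


/-! ### Central limit theorem for bounded triangular arrays -/

section Sample

variable {Ω : Type*} [MeasurableSpace Ω] {P : Measure Ω} [IsProbabilityMeasure P]
  {μ : Measure ℝ} {X : ℕ → Ω → ℝ}

lemma norm_exp_sub_quadratic_le {a : ℝ} (ha : |a| ≤ 1) :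
    ‖Complex.exp (a * Complex.I) - (1 + a * Complex.I - a ^ 2 / 2)‖ ≤ |a| ^ 3 := by
  have hn : ‖(a : ℂ) * Complex.I‖ = |a| := by simp
  have h := Complex.exp_bound (x := a * Complex.I) (by rwa [hn]) (n := 3) (by norm_num)
  rw [hn] at h
  have e : ∑ m ∈ Finset.range 3, ((a : ℂ) * Complex.I) ^ m / (m.factorial : ℂ) =
      1 + a * Complex.I - a ^ 2 / 2 := by
    simp [Finset.sum_range_succ, Nat.factorial, mul_pow]
    ring
  rw [e] at h
  refine h.trans (mul_le_of_le_one_right (by positivity) ?_)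
  norm_num [Nat.factorial]

/-- Second order expansion of the characteristic function of a bounded centred variable. -/
lemma norm_charFun_map_sub_quadratic_le {μ : Measure ℝ} [IsProbabilityMeasure μ] {g : ℝ → ℝ}
    (hg : Measurable g) {K : ℝ} (hK : ∀ y, |g y| ≤ K) (hmean : ∫ y, g y ∂μ = 0) {t : ℝ}
    (ht : |t| * K ≤ 1) :
    ‖charFun (μ.map g) t - (1 - t ^ 2 * (∫ y, g y ^ 2 ∂μ : ℝ) / 2)‖ ≤ (|t| * K) ^ 3 := by
  have hgi : Integrable g μ := .of_bound (by fun_prop) K (ae_of_all _ hK)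
  have hK0 : 0 ≤ K := (abs_nonneg _).trans (hK 0)
  have hg2 : Integrable (fun y => g y ^ 2) μ := by
    refine .of_bound (by fun_prop) (K ^ 2) (ae_of_all _ fun y => ?_)
    rw [norm_pow]
    exact pow_le_pow_left₀ (norm_nonneg _) (hK y) 2
  have hexp : Integrable (fun y => Complex.exp ((t * g y : ℝ) * Complex.I)) μ :=
    .of_bound (by fun_prop) 1 (ae_of_all _ fun y => (Complex.norm_exp_ofReal_mul_I _).le)
  have h1 : Integrable (fun y => ((t * g y : ℝ) : ℂ) * Complex.I) μ :=
    ((hgi.const_mul t).ofReal).mul_const _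
  have h2 : Integrable (fun y => (((t * g y : ℝ) : ℂ)) ^ 2 / 2) μ := by
    have : Integrable (fun y => ((t ^ 2 / 2 * g y ^ 2 : ℝ) : ℂ)) μ :=
      (hg2.const_mul (t ^ 2 / 2)).ofReal
    refine this.congr (ae_of_all _ fun y => ?_)
    push_cast
    ring
  have i1 : ∫ y, ((t * g y : ℝ) : ℂ) * Complex.I ∂μ = 0 := by
    rw [integral_mul_const, integral_complex_ofReal, integral_const_mul, hmean]
    simp
  have i2 : ∫ y, (((t * g y : ℝ) : ℂ)) ^ 2 / 2 ∂μ =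
      (t : ℂ) ^ 2 * (∫ y, g y ^ 2 ∂μ : ℝ) / 2 := by
    have : (fun y => (((t * g y : ℝ) : ℂ)) ^ 2 / 2) =
        fun y => ((t ^ 2 / 2 * g y ^ 2 : ℝ) : ℂ) := by
      funext y
      push_cast
      ring
    rw [this, integral_complex_ofReal, integral_const_mul]
    push_cast
    ring
  have e : charFun (μ.map g) t - (1 - t ^ 2 * (∫ y, g y ^ 2 ∂μ : ℝ) / 2) =
      ∫ y, (Complex.exp ((t * g y : ℝ) * Complex.I) -
        (1 + (t * g y : ℝ) * Complex.I - ((t * g y : ℝ) : ℂ) ^ 2 / 2)) ∂μ := by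
    have h0 : Integrable (fun y => 1 + ((t * g y : ℝ) : ℂ) * Complex.I) μ :=
      (integrable_const _).add h1
    have h3 : Integrable (fun y => 1 + ((t * g y : ℝ) : ℂ) * Complex.I -
      ((t * g y : ℝ) : ℂ) ^ 2 / 2) μ := h0.sub h2
    rw [integral_sub hexp h3, integral_sub h0 h2, integral_add (integrable_const _) h1,
      i1, i2,
      charFun_apply_real, integral_map hg.aemeasurable (by fun_prop)]
    simp
  rw [e]
  refine (norm_integral_le_of_norm_le_const (C := (|t| * K) ^ 3) (ae_of_all _ fun y => ?_)).trans
    (by simp)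
  have hle : |t * g y| ≤ |t| * K := by
    rw [abs_mul]
    gcongr
    exact hK y
  refine (norm_exp_sub_quadratic_le (hle.trans ht)).trans ?_
  gcongr

/-- Central limit theorem for a triangular array of uniformly bounded row functions of an i.i.d.
sequence. -/
theorem tendstoInDistribution_sum_triangular [IsProbabilityMeasure μ]
    (hXm : ∀ i, Measurable (X i)) (hind : iIndepFun X P) (hlaw : ∀ i, P.map (X i) = μ)
    {g : ℕ → ℝ → ℝ} (hg : ∀ n, Measurable (g n)) {K : ℝ}
    (hK : ∀ᶠ n in atTop, ∀ y, |g n y| ≤ K) (hmean : ∀ᶠ n in atTop, ∫ y, g n y ∂μ = 0)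
    {v : ℝ≥0} (hv : Tendsto (fun n => ∫ y, g n y ^ 2 ∂μ) atTop (𝓝 v)) :
    TendstoInDistribution (fun (n : ℕ) ω => (√n)⁻¹ * ∑ k ∈ Finset.range n, g n (X k ω)) atTop
      (id : ℝ → ℝ) (fun _ => P) (gaussianReal 0 v) where
  forall_aemeasurable n := by fun_prop
  tendsto := by
    refine ProbabilityMeasure.tendsto_iff_tendsto_charFun.2 fun t => ?_
    simp only [ProbabilityMeasure.coe_mk, Measure.map_id, charFun_gaussianReal]
    have hcf (n : ℕ) : charFun (P.map fun ω => (√n)⁻¹ * ∑ k ∈ Finset.range n, g n (X k ω)) t =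
        (charFun (μ.map (g n)) ((√n)⁻¹ * t)) ^ n := by
      rw [charFun_inv_sqrt_mul_sum (X := fun k ω => g n (X k ω))
        (hind.comp (fun _ => g n) fun _ => hg n) fun i => ?_]
      · rw [← hlaw 0, Measure.map_map (hg n) (hXm 0)]
        rfl
      · exact IdentDistrib.comp ⟨(hXm i).aemeasurable, (hXm 0).aemeasurable, by
          rw [hlaw i, hlaw 0]⟩ (hg n)
    simp only [hcf]
    have key : Tendsto (fun n : ℕ => charFun (μ.map (g n)) ((√n)⁻¹ * t) ^ n) atTop
        (𝓝 (Complex.exp (-(v * t ^ 2 / 2)))) := by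
      apply Complex.tendsto_pow_exp_of_isLittleO_sub_add_div
      rw [isLittleO_iff]
      intro c hc
      have hsq : Tendsto (fun n : ℕ => (√n)⁻¹) atTop (𝓝 0) :=
        tendsto_inv_atTop_zero.comp (Real.tendsto_sqrt_atTop.comp tendsto_natCast_atTop_atTop)
      have l1 : Tendsto (fun n : ℕ => (√n)⁻¹ * |t| * K) atTop (𝓝 (0 * |t| * K)) :=
        (hsq.mul_const _).mul_const _
      -- What remains of the expansion error once `1/n` is factored out: the cubic Taylor error and
      -- the discrepancy between the row variance and its limit.
      have l2 : Tendsto (fun n : ℕ => (√n)⁻¹ * (|t| * K) ^ 3 +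
          t ^ 2 / 2 * |(v : ℝ) - ∫ y, g n y ^ 2 ∂μ|) atTop
          (𝓝 (0 * (|t| * K) ^ 3 + t ^ 2 / 2 * |(v : ℝ) - v|)) :=
        (hsq.mul_const _).add ((tendsto_const_nhds.sub hv).abs.const_mul _)
      filter_upwards [hK, hmean, eventually_gt_atTop 0,
        l1.eventually (eventually_le_nhds (by simp : 0 * |t| * K < 1)),
        l2.eventually (eventually_le_nhds (by simpa using hc :
          0 * (|t| * K) ^ 3 + t ^ 2 / 2 * |(v : ℝ) - v| < c))] with n hKn hmn hn hl1 hl2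
      have hs : 0 < √(n : ℝ) := by positivity
      have hab : |(√n)⁻¹ * t| = (√n)⁻¹ * |t| := by rw [abs_mul, abs_of_nonneg (by positivity)]
      have hb := norm_charFun_map_sub_quadratic_le (μ := μ) (hg n) hKn hmn (t := (√n)⁻¹ * t)
        (by rwa [hab])
      have hinv : (√n)⁻¹ * (√n)⁻¹ = 1 / (n : ℝ) := by
        rw [← mul_inv, Real.mul_self_sqrt (by positivity), one_div]
      set q := ∫ y, g n y ^ 2 ∂μ
      have e : charFun (μ.map (g n)) ((√n)⁻¹ * t) - (1 + -(v * t ^ 2 / 2 : ℂ) / n) =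
          (charFun (μ.map (g n)) ((√n)⁻¹ * t) - (1 - (((√n)⁻¹ * t : ℝ) : ℂ) ^ 2 * q / 2)) +
            ((1 / (n : ℝ) * (t ^ 2 / 2 * (v - q)) : ℝ) : ℂ) := by
        have h3 : (((√n)⁻¹ * t : ℝ) : ℂ) ^ 2 = ((1 / (n : ℝ) * t ^ 2 : ℝ) : ℂ) := by
          rw [← hinv]
          push_cast
          ring
        rw [h3]
        push_cast
        ring
      rw [e]
      refine (norm_add_le _ _).trans ((add_le_add hb le_rfl).trans ?_)
      rw [Complex.norm_real, hab, Real.norm_eq_abs, abs_mul, abs_of_nonneg (by positivity :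
        0 ≤ 1 / (n : ℝ)), abs_mul, abs_of_nonneg (by positivity : 0 ≤ t ^ 2 / 2), norm_div,
        norm_one, Complex.norm_natCast]
      calc ((√n)⁻¹ * |t| * K) ^ 3 + 1 / (n : ℝ) * (t ^ 2 / 2 * |(v : ℝ) - q|)
          = 1 / (n : ℝ) * ((√n)⁻¹ * (|t| * K) ^ 3 + t ^ 2 / 2 * |(v : ℝ) - q|) := by
            rw [← hinv]; ring
        _ ≤ 1 / (n : ℝ) * c := by gcongr
        _ = c * (1 / (n : ℝ)) := mul_comm _ _
    convert! key using 2
    push_cast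
    simp

/-! ### Deviations of the empirical characteristic function -/

/-- The mean square error of a sample mean. -/
lemma integral_sq_mean_sub_le [IsProbabilityMeasure μ]
    (hXm : ∀ i, Measurable (X i)) (hind : iIndepFun X P) (hlaw : ∀ i, P.map (X i) = μ)
    {a : ℝ → ℝ} (ha : Measurable a) (ha1 : ∀ y, |a y| ≤ 1) {n : ℕ} (hn : n ≠ 0) :
    ∫ ω, (1 / (n : ℝ) * ∑ j ∈ Finset.range n, a (X j ω) - ∫ y, a y ∂μ) ^ 2 ∂P ≤
      1 / (n : ℝ) * ∫ y, a y ^ 2 ∂μ := by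
  have hn' : (n : ℝ) ≠ 0 := by exact_mod_cast hn
  have hmem (j : ℕ) : MemLp (fun ω => a (X j ω)) 2 P :=
    MemLp.of_bound (ha.comp (hXm j)).aestronglyMeasurable 1 (ae_of_all _ fun ω => ha1 _)
  have hint (j : ℕ) : ∫ ω, a (X j ω) ∂P = ∫ y, a y ∂μ := by
    rw [← hlaw j, integral_map (hXm j).aemeasurable (by fun_prop)]
  have hint2 (j : ℕ) : ∫ ω, a (X j ω) ^ 2 ∂P = ∫ y, a y ^ 2 ∂μ := by
    rw [← hlaw j, integral_map (hXm j).aemeasurable (by fun_prop)]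
  have hvar : Var[∑ j ∈ Finset.range n, fun ω => a (X j ω); P] =
      ∑ j ∈ Finset.range n, Var[fun ω => a (X j ω); P] :=
    IndepFun.variance_sum (fun j _ => hmem j) fun i _ j _ hij =>
      (hind.indepFun hij).comp ha ha
  have hsum : ∑ j ∈ Finset.range n, Var[fun ω => a (X j ω); P] ≤ n * ∫ y, a y ^ 2 ∂μ := by
    calc ∑ j ∈ Finset.range n, Var[fun ω => a (X j ω); P]
        ≤ ∑ j ∈ Finset.range n, ∫ y, a y ^ 2 ∂μ := by
          refine Finset.sum_le_sum fun j _ => ?_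
          rw [← hint2 j]
          exact variance_le_expectation_sq (ha.comp (hXm j)).aestronglyMeasurable
      _ = _ := by simp
  have hmean : P[∑ j ∈ Finset.range n, fun ω => a (X j ω)] = n * ∫ y, a y ∂μ := by
    simp only [Finset.sum_apply]
    rw [integral_finsetSum _ fun j _ => (hmem j).integrable (by norm_num)]
    simp [hint]
  rw [variance_eq_integral (by fun_prop), hmean] at hvar
  have e : ∀ ω, (1 / (n : ℝ) * ∑ j ∈ Finset.range n, a (X j ω) - ∫ y, a y ∂μ) ^ 2 =
      (1 / (n : ℝ)) ^ 2 * ((∑ j ∈ Finset.range n, fun ω => a (X j ω)) ω - n * ∫ y, a y ∂μ) ^ 2 := by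
    intro ω
    simp only [Finset.sum_apply]
    field_simp
  simp only [e]
  rw [integral_const_mul, hvar]
  calc (1 / (n : ℝ)) ^ 2 * ∑ j ∈ Finset.range n, Var[fun ω => a (X j ω); P]
      ≤ (1 / (n : ℝ)) ^ 2 * (n * ∫ y, a y ^ 2 ∂μ) := by gcongr
    _ = _ := by field_simp

/-- A two-sided Hoeffding inequality for sample means of a function with values in `[-1, 1]`. -/
lemma measureReal_abs_mean_sub_ge_le
    (hXm : ∀ i, Measurable (X i)) (hind : iIndepFun X P) (hlaw : ∀ i, P.map (X i) = μ)
    {a : ℝ → ℝ} (ha : Measurable a) (ha1 : ∀ y, |a y| ≤ 1) {n : ℕ} (hn : n ≠ 0) {ε : ℝ}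
    (hε : 0 ≤ ε) :
    P.real {ω | ε ≤ |1 / (n : ℝ) * ∑ j ∈ Finset.range n, a (X j ω) - ∫ y, a y ∂μ|} ≤
      2 * Real.exp (-(n * ε ^ 2 / 2)) := by
  have hn' : 0 < (n : ℝ) := by positivity
  have hint (j : ℕ) : ∫ ω, a (X j ω) ∂P = ∫ y, a y ∂μ := by
    rw [← hlaw j, integral_map (hXm j).aemeasurable (by fun_prop)]
  have one_sided {b : ℝ → ℝ} (hb : Measurable b) (hb1 : ∀ y, |b y| ≤ 1) :
      P.real {ω | n * ε ≤ ∑ j ∈ Finset.range n, (b (X j ω) - ∫ ω, b (X j ω) ∂P)} ≤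
        Real.exp (-(n * ε ^ 2 / 2)) := by
    -- Values in `[-1, 1]` give the variance proxy `((1 - (-1))/2)² = 1`.
    have hsub (j : ℕ) : HasSubgaussianMGF (fun ω => b (X j ω) - ∫ ω, b (X j ω) ∂P) 1 P := by
      have := hasSubgaussianMGF_of_mem_Icc (μ := P) (X := fun ω => b (X j ω)) (a := -1) (b := 1)
        (by fun_prop) (ae_of_all _ fun ω => abs_le.1 (hb1 _))
      convert! this using 1
      ext
      norm_num
    have hi : iIndepFun (fun j ω => b (X j ω) - ∫ ω, b (X j ω) ∂P) P :=
      hind.comp (fun j y => b y - ∫ ω, b (X j ω) ∂P) fun j => by fun_prop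
    refine (HasSubgaussianMGF.measure_sum_range_ge_le_of_iIndepFun hi (fun j _ => hsub j)
      (by positivity : 0 ≤ n * ε)).trans (Real.exp_le_exp.2 (le_of_eq ?_))
    push_cast
    field_simp
  have h1 := one_sided ha ha1
  have h2 := one_sided (b := fun y => -a y) (by fun_prop) (by simpa using ha1)
  simp only [integral_neg, hint] at h1 h2
  have hsub : {ω | ε ≤ |1 / (n : ℝ) * ∑ j ∈ Finset.range n, a (X j ω) - ∫ y, a y ∂μ|} ⊆
      {ω | n * ε ≤ ∑ j ∈ Finset.range n, (a (X j ω) - ∫ y, a y ∂μ)} ∪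
        {ω | n * ε ≤ ∑ j ∈ Finset.range n, (-a (X j ω) - -∫ y, a y ∂μ)} := by
    intro ω hω
    simp only [Set.mem_ofPred_eq, Set.mem_union, Finset.sum_sub_distrib, Finset.sum_neg_distrib,
      Finset.sum_const, Finset.card_range, nsmul_eq_mul] at hω ⊢
    have e : 1 / (n : ℝ) * ∑ j ∈ Finset.range n, a (X j ω) - ∫ y, a y ∂μ =
        (∑ j ∈ Finset.range n, a (X j ω) - n * ∫ y, a y ∂μ) / n := by field_simp
    rw [e, abs_div, abs_of_pos hn', le_div_iff₀ hn', le_abs] at hω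
    rcases hω with h | h
    · left; linarith
    · right; linarith
  calc P.real {ω | ε ≤ |1 / (n : ℝ) * ∑ j ∈ Finset.range n, a (X j ω) - ∫ y, a y ∂μ|}
      ≤ _ := measureReal_mono hsub
    _ ≤ _ := measureReal_union_le _ _
    _ ≤ _ := by linarith

lemma empCharFun_re (s : ℕ → ℝ) (n : ℕ) (t : ℝ) :
    (empCharFun s n t).re = 1 / (n : ℝ) * ∑ j ∈ Finset.range n, Real.cos (t * s j) := by
  have : (1 / (n : ℂ)) = ((1 / (n : ℝ) : ℝ) : ℂ) := by push_cast; rfl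
  rw [empCharFun, this, Complex.re_ofReal_mul, Complex.re_sum]
  congr 1
  refine Finset.sum_congr rfl fun j _ => ?_
  rw [show Complex.I * t * s j = ((t * s j : ℝ) : ℂ) * Complex.I by push_cast; ring,
    Complex.exp_ofReal_mul_I_re]

lemma empCharFun_im (s : ℕ → ℝ) (n : ℕ) (t : ℝ) :
    (empCharFun s n t).im = 1 / (n : ℝ) * ∑ j ∈ Finset.range n, Real.sin (t * s j) := by
  have : (1 / (n : ℂ)) = ((1 / (n : ℝ) : ℝ) : ℂ) := by push_cast; rfl
  rw [empCharFun, this, Complex.im_ofReal_mul, Complex.im_sum]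
  congr 1
  refine Finset.sum_congr rfl fun j _ => ?_
  rw [show Complex.I * t * s j = ((t * s j : ℝ) : ℂ) * Complex.I by push_cast; ring,
    Complex.exp_ofReal_mul_I_im]

lemma integrable_cexp_ofReal_mul_I [IsFiniteMeasure μ] (t : ℝ) :
    Integrable (fun y : ℝ => Complex.exp (t * y * Complex.I)) μ := by
  refine .of_bound (by fun_prop) 1 (ae_of_all _ fun y => ?_)
  rw [← Complex.ofReal_mul, Complex.norm_exp_ofReal_mul_I]

lemma charFun_re [IsFiniteMeasure μ] (t : ℝ) :
    (charFun μ t).re = ∫ y, Real.cos (t * y) ∂μ := by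
  rw [charFun_apply_real]
  have := Complex.reCLM.integral_comp_comm (integrable_cexp_ofReal_mul_I (μ := μ) t)
  simp only [Complex.reCLM_apply] at this
  rw [← this]
  congr 1
  funext y
  rw [← Complex.ofReal_mul, Complex.exp_ofReal_mul_I_re]

lemma charFun_im [IsFiniteMeasure μ] (t : ℝ) :
    (charFun μ t).im = ∫ y, Real.sin (t * y) ∂μ := by
  rw [charFun_apply_real]
  have := Complex.imCLM.integral_comp_comm (integrable_cexp_ofReal_mul_I (μ := μ) t)
  simp only [Complex.imCLM_apply] at this
  rw [← this]
  congr 1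
  funext y
  rw [← Complex.ofReal_mul, Complex.exp_ofReal_mul_I_im]

/-- The mean square error of the empirical characteristic function. -/
lemma integral_norm_empCharFun_sub_sq_le [IsProbabilityMeasure μ]
    (hXm : ∀ i, Measurable (X i)) (hind : iIndepFun X P) (hlaw : ∀ i, P.map (X i) = μ)
    {n : ℕ} (hn : n ≠ 0) (t : ℝ) :
    ∫ ω, ‖empCharFun (fun i => X i ω) n t - charFun μ t‖ ^ 2 ∂P ≤ 1 / (n : ℝ) := by
  have hc := integral_sq_mean_sub_le hXm hind hlaw (a := fun y => Real.cos (t * y)) (by fun_prop)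
    (fun y => Real.abs_cos_le_one _) hn
  have hs := integral_sq_mean_sub_le hXm hind hlaw (a := fun y => Real.sin (t * y)) (by fun_prop)
    (fun y => Real.abs_sin_le_one _) hn
  have e : ∀ ω, ‖empCharFun (fun i => X i ω) n t - charFun μ t‖ ^ 2 =
      (1 / (n : ℝ) * ∑ j ∈ Finset.range n, Real.cos (t * X j ω) - ∫ y, Real.cos (t * y) ∂μ) ^ 2 +
      (1 / (n : ℝ) * ∑ j ∈ Finset.range n, Real.sin (t * X j ω) - ∫ y, Real.sin (t * y) ∂μ) ^ 2 := by
    intro ω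
    rw [Complex.sq_norm, Complex.normSq_apply, Complex.sub_re, Complex.sub_im, empCharFun_re,
      empCharFun_im, charFun_re, charFun_im]
    ring
  have hint {a : ℝ → ℝ} (ha : Measurable a) (ha1 : ∀ y, |a y| ≤ 1) (c : ℝ) :
      Integrable (fun ω => (1 / (n : ℝ) * ∑ j ∈ Finset.range n, a (X j ω) - c) ^ 2) P := by
    have h1 : MemLp (fun ω => ∑ j ∈ Finset.range n, a (X j ω)) 2 P :=
      memLp_finsetSum (Finset.range n) fun j _ =>
        MemLp.of_bound (ha.comp (hXm j)).aestronglyMeasurable 1 (ae_of_all _ fun ω => ha1 _)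
    have h2 : MemLp (fun ω => 1 / (n : ℝ) * ∑ j ∈ Finset.range n, a (X j ω) - c) 2 P :=
      (h1.const_mul _).sub (memLp_const c)
    exact h2.integrable_sq
  have htrig {a : ℝ → ℝ} (ha : Measurable a) (ha1 : ∀ y, |a y| ≤ 1) :
      Integrable (fun y => a y ^ 2) μ := by
    refine .of_bound (by fun_prop) 1 (ae_of_all _ fun y => ?_)
    rw [norm_pow]
    exact pow_le_one₀ (norm_nonneg _) (ha1 y)
  simp only [e]
  rw [integral_add (hint (a := fun y => Real.cos (t * y)) (by fun_prop)
    (fun y => Real.abs_cos_le_one _) _) (hint (a := fun y => Real.sin (t * y)) (by fun_prop)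
    (fun y => Real.abs_sin_le_one _) _)]
  -- The bounds for the real and imaginary parts add up to `1/n`, since `cos² + sin² = 1`.
  refine (add_le_add hc hs).trans (le_of_eq ?_)
  rw [← mul_add, ← integral_add (htrig (a := fun y => Real.cos (t * y)) (by fun_prop)
    (fun y => Real.abs_cos_le_one _)) (htrig (a := fun y => Real.sin (t * y)) (by fun_prop)
    (fun y => Real.abs_sin_le_one _))]
  simp

lemma norm_cexp_sub_cexp_le (t u y : ℝ) :
    ‖Complex.exp (Complex.I * t * y) - Complex.exp (Complex.I * u * y)‖ ≤ |t - u| * |y| := by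
  have e : Complex.exp (Complex.I * t * y) - Complex.exp (Complex.I * u * y) =
      Complex.exp (Complex.I * u * y) * (Complex.exp (Complex.I * ((t - u) * y : ℝ)) - 1) := by
    rw [mul_sub, ← Complex.exp_add, mul_one]
    push_cast
    ring_nf
  rw [e, norm_mul, show Complex.I * u * y = ((u * y : ℝ) : ℂ) * Complex.I by push_cast; ring,
    Complex.norm_exp_ofReal_mul_I, one_mul, ← abs_mul]
  exact Real.norm_exp_I_mul_ofReal_sub_one_le

lemma norm_empCharFun_sub_le (s : ℕ → ℝ) (n : ℕ) (t u : ℝ) :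
    ‖empCharFun s n t - empCharFun s n u‖ ≤
      |t - u| * (1 / (n : ℝ) * ∑ j ∈ Finset.range n, |s j|) := by
  rw [empCharFun, empCharFun, ← mul_sub, ← Finset.sum_sub_distrib, norm_mul, norm_div, norm_one,
    Complex.norm_natCast, mul_left_comm, Finset.mul_sum]
  gcongr
  exact norm_sum_le_of_le _ fun j _ => norm_cexp_sub_cexp_le _ _ _

lemma norm_charFun_sub_le [IsProbabilityMeasure μ] (hμ : Integrable id μ) (t u : ℝ) :
    ‖charFun μ t - charFun μ u‖ ≤ |t - u| * ∫ y, |y| ∂μ := by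
  rw [charFun_apply_real, charFun_apply_real, ← integral_sub (integrable_cexp_ofReal_mul_I t)
    (integrable_cexp_ofReal_mul_I u), ← integral_const_mul]
  refine norm_integral_le_of_norm_le (hμ.abs.const_mul _) (ae_of_all _ fun y => ?_)
  have := norm_cexp_sub_cexp_le t u y
  rwa [show Complex.I * t * y = t * y * Complex.I by ring,
    show Complex.I * u * y = u * y * Complex.I by ring] at this

/-- A deviation of modulus at least `ε` forces the real or the imaginary part to deviate by at least
`ε/2`; Hoeffding's inequality applies to each. -/
lemma measureReal_norm_empCharFun_sub_ge_le [IsProbabilityMeasure μ]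
    (hXm : ∀ i, Measurable (X i)) (hind : iIndepFun X P) (hlaw : ∀ i, P.map (X i) = μ)
    {n : ℕ} (hn : n ≠ 0) (t : ℝ) {ε : ℝ} (hε : 0 ≤ ε) :
    P.real {ω | ε ≤ ‖empCharFun (fun i => X i ω) n t - charFun μ t‖} ≤
      4 * Real.exp (-(n * ε ^ 2 / 8)) := by
  have hc := measureReal_abs_mean_sub_ge_le hXm hind hlaw (a := fun y => Real.cos (t * y))
    (by fun_prop) (fun y => Real.abs_cos_le_one _) hn (ε := ε / 2) (by positivity)
  have hs := measureReal_abs_mean_sub_ge_le hXm hind hlaw (a := fun y => Real.sin (t * y))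
    (by fun_prop) (fun y => Real.abs_sin_le_one _) hn (ε := ε / 2) (by positivity)
  rw [show (n : ℝ) * (ε / 2) ^ 2 / 2 = n * ε ^ 2 / 8 by ring] at hc hs
  have hsub : {ω | ε ≤ ‖empCharFun (fun i => X i ω) n t - charFun μ t‖} ⊆
      {ω | ε / 2 ≤ |1 / (n : ℝ) * ∑ j ∈ Finset.range n, Real.cos (t * X j ω) -
        ∫ y, Real.cos (t * y) ∂μ|} ∪
      {ω | ε / 2 ≤ |1 / (n : ℝ) * ∑ j ∈ Finset.range n, Real.sin (t * X j ω) -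
        ∫ y, Real.sin (t * y) ∂μ|} := by
    intro ω hω
    have h1 := Complex.norm_le_abs_re_add_abs_im (empCharFun (fun i => X i ω) n t - charFun μ t)
    rw [Complex.sub_re, Complex.sub_im, empCharFun_re, empCharFun_im, charFun_re, charFun_im] at h1
    simp only [Set.mem_ofPred_eq, Set.mem_union] at hω ⊢
    by_contra! hcon
    linarith [hcon.1, hcon.2]
  exact (measureReal_mono hsub).trans ((measureReal_union_le _ _).trans (by linarith))

/-- Off an event of small probability, the empirical characteristic function is uniformly close to
the characteristic function on `[-T, T]`. -/
lemma exists_measurableSet_norm_empCharFun_sub_le [IsProbabilityMeasure μ]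
    (hXm : ∀ i, Measurable (X i)) (hind : iIndepFun X P) (hlaw : ∀ i, P.map (X i) = μ)
    (hμ : Integrable id μ) {n : ℕ} (hn : n ≠ 0) {T : ℝ} (hT : 0 < T) {ε : ℝ} (hε : 0 < ε) :
    ∃ B : Set Ω, MeasurableSet B ∧
      P.real B ≤ (∫ y, |y| ∂μ) / n + (4 * T * (n + ∫ y, |y| ∂μ) / ε + 2) *
        (4 * Real.exp (-(n * ε ^ 2 / 32))) ∧
      ∀ ω ∉ B, ∀ t ∈ Set.Icc (-T) T,
        ‖empCharFun (fun i => X i ω) n t - charFun μ t‖ ≤ ε := by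
  set m := ∫ y, |y| ∂μ with hm
  have hm0 : 0 ≤ m := integral_nonneg fun _ => abs_nonneg _
  have hn' : 0 < (n : ℝ) := by positivity
  -- The mesh makes the Lipschitz error at most `ε/2`: off `A` the empirical function has Lipschitz
  -- constant at most `n`, and the true one has constant `m`.
  set δ := ε / (2 * (n + m)) with hδ
  have hδ0 : 0 < δ := by positivity
  set N := ⌊2 * T / δ⌋₊ with hN
  -- The crude level `n` for the mean of the `|X_j|` suffices: Markov's inequality gives probability
  -- at most `m/n`.
  set A := {ω | (n : ℝ) ≤ 1 / (n : ℝ) * ∑ j ∈ Finset.range n, |X j ω|} with hA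
  set G := fun k : ℕ => {ω | ε / 2 ≤
    ‖empCharFun (fun i => X i ω) n (-T + k * δ) - charFun μ (-T + k * δ)‖} with hG
  have hXs : Measurable fun ω i => X i ω := measurable_pi_lambda _ hXm
  have hempm (t : ℝ) : Measurable fun ω => empCharFun (fun i => X i ω) n t := by
    unfold empCharFun
    fun_prop
  have hAm : MeasurableSet A := measurableSet_le measurable_const (by fun_prop)
  have hGm (k : ℕ) : MeasurableSet (G k) :=
    measurableSet_le measurable_const ((hempm _).sub_const _).norm
  refine ⟨A ∪ ⋃ k ∈ Finset.range (N + 1), G k,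
    hAm.union (Finset.measurableSet_biUnion _ fun k _ => hGm k), ?_, ?_⟩
  · have hPA : P.real A ≤ m / n := by
      have hj (j : ℕ) : Integrable (fun ω => |X j ω|) P := by
        have : Integrable (X j) P := by
          rw [← hlaw j] at hμ
          exact hμ.comp_measurable (hXm j)
        exact this.abs
      have hI : Integrable (fun ω => 1 / (n : ℝ) * ∑ j ∈ Finset.range n, |X j ω|) P :=
        (integrable_finsetSum _ fun j _ => hj j).const_mul _
      have hEI : ∫ ω, 1 / (n : ℝ) * ∑ j ∈ Finset.range n, |X j ω| ∂P = m := by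
        rw [integral_const_mul, integral_finsetSum _ fun j _ => hj j]
        have : ∀ j, ∫ ω, |X j ω| ∂P = m := fun j => by
          rw [hm, ← hlaw j, integral_map (hXm j).aemeasurable (by fun_prop)]
        simp only [this, Finset.sum_const, Finset.card_range, nsmul_eq_mul]
        field_simp
      have := mul_meas_ge_le_integral_of_nonneg
        (ae_of_all P fun ω => (by positivity : 0 ≤ 1 / (n : ℝ) * ∑ j ∈ Finset.range n, |X j ω|))
        hI n
      rw [hEI] at this
      rw [le_div_iff₀ hn', mul_comm]
      exact this
    have hPG (k : ℕ) : P.real (G k) ≤ 4 * Real.exp (-(n * ε ^ 2 / 32)) := by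
      refine (measureReal_norm_empCharFun_sub_ge_le hXm hind hlaw hn _
        (by positivity : 0 ≤ ε / 2)).trans (le_of_eq ?_)
      ring_nf
    have hNle : ((N + 1 : ℕ) : ℝ) ≤ 4 * T * (n + m) / ε + 2 := by
      have h1 : (N : ℝ) ≤ 2 * T / δ := Nat.floor_le (by positivity)
      have h2 : 2 * T / δ = 4 * T * (n + m) / ε := by
        rw [hδ]
        field_simp
        ring
      push_cast
      linarith
    calc P.real (A ∪ ⋃ k ∈ Finset.range (N + 1), G k)
        ≤ P.real A + P.real (⋃ k ∈ Finset.range (N + 1), G k) := measureReal_union_le _ _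
      _ ≤ m / n + ∑ k ∈ Finset.range (N + 1), P.real (G k) :=
          add_le_add hPA (measureReal_biUnion_finset_le _ _)
      _ ≤ m / n + ∑ k ∈ Finset.range (N + 1), 4 * Real.exp (-(n * ε ^ 2 / 32)) := by
          gcongr with k
          exact hPG k
      _ = m / n + ((N + 1 : ℕ) : ℝ) * (4 * Real.exp (-(n * ε ^ 2 / 32))) := by
          rw [Finset.sum_const, Finset.card_range, nsmul_eq_mul]
      _ ≤ _ := by gcongr
  · intro ω hω t ht
    simp only [Set.mem_union, Set.mem_iUnion, not_or, not_exists, hA, hG, Set.mem_ofPred_eq,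
      not_le, Finset.mem_range] at hω
    obtain ⟨hω1, hω2⟩ := hω
    -- The grid point just to the left of `t`.
    set k := ⌊(t + T) / δ⌋₊ with hk
    have htT : 0 ≤ (t + T) / δ := div_nonneg (by linarith [ht.1]) hδ0.le
    have hkN : k < N + 1 := by
      refine Nat.lt_succ_of_le (Nat.floor_le_floor ?_)
      gcongr
      linarith [ht.2]
    have h1 := hω2 k hkN
    have h2 : (k : ℝ) * δ ≤ t + T := (le_div_iff₀ hδ0).1 (Nat.floor_le htT)
    have h3 : t + T < (k + 1) * δ := (div_lt_iff₀ hδ0).1 (Nat.lt_floor_add_one _)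
    set u := -T + k * δ with hu
    have habs : |t - u| ≤ δ := by
      rw [abs_le]
      constructor <;> linarith
    have h4 := norm_empCharFun_sub_le (fun i => X i ω) n t u
    have h5 := norm_charFun_sub_le hμ u t
    rw [abs_sub_comm u t] at h5
    have e : empCharFun (fun i => X i ω) n t - charFun μ t =
        (empCharFun (fun i => X i ω) n t - empCharFun (fun i => X i ω) n u) +
        (empCharFun (fun i => X i ω) n u - charFun μ u) + (charFun μ u - charFun μ t) := by ring
    have h6 : |t - u| * (1 / (n : ℝ) * ∑ j ∈ Finset.range n, |X j ω|) + |t - u| * m ≤ ε / 2 := by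
      rw [← mul_add]
      calc |t - u| * (1 / (n : ℝ) * ∑ j ∈ Finset.range n, |X j ω| + m) ≤ δ * (n + m) := by
            gcongr
        _ = ε / 2 := by rw [hδ]; field_simp
    rw [e]
    refine (norm_add₃_le).trans ?_
    linarith

end Sample


/-! ### Limiting moments of the rescaled summand -/

lemma measurable_linStat (lam : ℝ) {φ : ℝ → ℂ} (hφ : Continuous φ) (x : ℝ) {T : ℝ}
    (hT : 0 ≤ T) : Measurable (linStat lam φ x T) := by
  unfold linStat
  refine Measurable.const_mul (Complex.measurable_re.comp ?_) _
  simp only [intervalIntegral.integral_of_le (by linarith : -T ≤ T)]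
  have hm : Measurable fun p : ℝ × ℝ =>
      Complex.exp (Complex.I * p.2 * (p.1 - x)) * invMixCF lam φ p.2 :=
    Measurable.mul (by fun_prop) ((continuous_invMixCF lam hφ).measurable.comp measurable_snd)
  exact (hm.stronglyMeasurable.integral_prod_right').measurable

section Moments

variable {μ : Measure ℝ} [IsProbabilityMeasure μ]

lemma abs_integral_cos_mul_sub_le (t x : ℝ) :
    |∫ y, Real.cos (t * (y - x)) ∂μ| ≤ 2 * ‖charFun μ t‖ := by
  have hc : Integrable (fun y => Real.cos (t * y)) μ :=
    .of_bound (by fun_prop) 1 (ae_of_all _ fun y => Real.abs_cos_le_one _)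
  have hs : Integrable (fun y => Real.sin (t * y)) μ :=
    .of_bound (by fun_prop) 1 (ae_of_all _ fun y => Real.abs_sin_le_one _)
  have e : ∫ y, Real.cos (t * (y - x)) ∂μ =
      (charFun μ t).re * Real.cos (t * x) + (charFun μ t).im * Real.sin (t * x) := by
    rw [charFun_re, charFun_im, ← integral_mul_const, ← integral_mul_const,
      ← integral_add (hc.mul_const _) (hs.mul_const _)]
    congr 1
    funext y
    rw [mul_sub, Real.cos_sub]
  rw [e]
  refine (abs_add_le _ _).trans ?_
  rw [abs_mul, abs_mul, two_mul]
  refine add_le_add ?_ ?_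
  · exact (mul_le_of_le_one_right (abs_nonneg _) (Real.abs_cos_le_one _)).trans
      (Complex.abs_re_le_norm _)
  · exact (mul_le_of_le_one_right (abs_nonneg _) (Real.abs_sin_le_one _)).trans
      (Complex.abs_im_le_norm _)

/-- The double-angle formula turns the deviation from `1/2` into half a cosine moment at frequency
`2t`. -/
lemma abs_integral_cos_sq_sub_half_le (t x : ℝ) :
    |∫ y, Real.cos (t * (y - x)) ^ 2 ∂μ - 1 / 2| ≤ ‖charFun μ (2 * t)‖ := by
  have h1 := abs_integral_cos_mul_sub_le (μ := μ) (2 * t) x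
  have hc : Integrable (fun y => Real.cos (2 * t * (y - x))) μ :=
    .of_bound (by fun_prop) 1 (ae_of_all _ fun y => Real.abs_cos_le_one _)
  have e : ∫ y, Real.cos (t * (y - x)) ^ 2 ∂μ =
      1 / 2 + (∫ y, Real.cos (2 * t * (y - x)) ∂μ) / 2 := by
    have : ∀ y, Real.cos (t * (y - x)) ^ 2 = 1 / 2 + Real.cos (2 * t * (y - x)) / 2 := by
      intro y
      rw [Real.cos_sq, mul_assoc 2]
    simp only [this]
    rw [integral_add (integrable_const _) (hc.div_const _),
      integral_div 2 fun y => Real.cos (2 * t * (y - x))]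
    simp
  rw [e, add_sub_cancel_left, abs_div, abs_two]
  linarith

variable {lam : ℝ} {φ : ℝ → ℂ}

lemma eventually_abs_scaledStat_le (hlam : 0 < lam) (hφ : ∀ t, ‖φ t‖ ≤ 1) (x : ℝ) :
    ∀ᶠ T in atTop, ∀ y, |scaledStat lam φ x T y| ≤
      2 * Real.exp (2 * lam) / (Real.pi * lam) := by
  have hpi := Real.pi_pos
  filter_upwards [tendsto_integral_edgeWeight.eventually (eventually_le_nhds one_lt_two),
    eventually_ge_atTop 0] with T hT hT0 y
  refine (abs_scaledStat_le hlam hφ x y hT0).trans ?_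
  calc Real.exp (2 * lam) / (Real.pi * lam) * ∫ t in (0 : ℝ)..T, edgeWeight T t
      ≤ Real.exp (2 * lam) / (Real.pi * lam) * 2 := by gcongr
    _ = _ := by ring

/-- The rescaled contribution of an observation is close to a cosine in mean. -/
lemma tendsto_integral_abs_scaledStat_sub_cos (hlam : 0 < lam) (hφc : Continuous φ)
    (hφ : ∀ t, ‖φ t‖ ≤ 1) (hlim : Tendsto φ (cocompact ℝ) (𝓝 0)) (hμ : Integrable id μ) (x : ℝ) :
    Tendsto (fun T => ∫ y, |scaledStat lam φ x T y -
      Real.exp lam / (Real.pi * lam) * Real.cos (T * (y - x))| ∂μ) atTop (𝓝 0) := by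
  have hpi := Real.pi_pos
  set c := Real.exp lam / (Real.pi * lam) with hc
  have hc0 : 0 ≤ c := by positivity
  have hI : Integrable (fun y => |y - x|) μ := (hμ.sub (integrable_const x)).abs
  have h1 : Tendsto (fun T : ℝ =>
      c * ((∫ t in (-T)..T, edgeWeight T t * ‖Complex.exp (-(lam * φ t)) - 1‖) +
          |(∫ t in (0 : ℝ)..T, edgeWeight T t) - 1| + 16 / T * ∫ y, |y - x| ∂μ)) atTop
      (𝓝 (c * (0 + |(1 : ℝ) - 1| + 0 * ∫ y, |y - x| ∂μ))) := by
    refine (((tendsto_integral_edgeWeight_mul_norm_exp_sub_one hlam.le hφc hφ hlim).add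
      (tendsto_integral_edgeWeight.sub_const 1).abs).add (Tendsto.mul_const _ ?_)).const_mul c
    exact tendsto_const_nhds.div_atTop tendsto_id
  simp only [sub_self, abs_zero, zero_mul, add_zero, mul_zero] at h1
  refine squeeze_zero' (Eventually.of_forall fun T => integral_nonneg fun _ => abs_nonneg _) ?_ h1
  filter_upwards [eventually_gt_atTop 0] with T hT
  set A := (∫ t in (-T)..T, edgeWeight T t * ‖Complex.exp (-(lam * φ t)) - 1‖) +
    |(∫ t in (0 : ℝ)..T, edgeWeight T t) - 1|
  have hint : Integrable (fun y => c * (A + 16 / T * |y - x|)) μ :=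
    ((integrable_const A).add (hI.const_mul _)).const_mul c
  calc ∫ y, |scaledStat lam φ x T y - c * Real.cos (T * (y - x))| ∂μ
      ≤ ∫ y, c * (A + 16 / T * |y - x|) ∂μ :=
        integral_mono_of_nonneg (ae_of_all _ fun _ => abs_nonneg _) hint
          (ae_of_all _ fun y => abs_scaledStat_sub_cos_le hlam hφc x y hT)
    _ = c * (A + 16 / T * ∫ y, |y - x| ∂μ) := by
        rw [integral_const_mul, integral_add (integrable_const _) (hI.const_mul _),
          integral_const_mul]
        simp

lemma measurable_scaledStat (hφc : Continuous φ) (x : ℝ) {T : ℝ} (hT : 0 ≤ T) :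
    Measurable (scaledStat lam φ x T) :=
  (measurable_linStat lam hφc x hT).const_mul _

lemma tendsto_integral_scaledStat (hlam : 0 < lam) (hφc : Continuous φ)
    (hφ : ∀ t, ‖φ t‖ ≤ 1) (hlim : Tendsto φ (cocompact ℝ) (𝓝 0)) (hμ : Integrable id μ)
    (hcf : Tendsto (charFun μ) atTop (𝓝 0)) (x : ℝ) :
    Tendsto (fun T => ∫ y, scaledStat lam φ x T y ∂μ) atTop (𝓝 0) := by
  have hpi := Real.pi_pos
  set c := Real.exp lam / (Real.pi * lam) with hc
  have hc0 : 0 ≤ c := by positivity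
  have h1 := (tendsto_integral_abs_scaledStat_sub_cos hlam hφc hφ hlim hμ x).add
    ((hcf.norm.const_mul 2).const_mul c)
  rw [norm_zero, mul_zero, mul_zero, add_zero] at h1
  refine squeeze_zero_norm' ?_ h1
  filter_upwards [eventually_abs_scaledStat_le hlam hφ x, eventually_ge_atTop 0] with T hT hT0
  have hI1 : Integrable (scaledStat lam φ x T) μ :=
    .of_bound (measurable_scaledStat hφc x hT0).aestronglyMeasurable _ (ae_of_all _ hT)
  have hI2 : Integrable (fun y => c * Real.cos (T * (y - x))) μ :=
    Integrable.const_mul (.of_bound (by fun_prop) 1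
      (ae_of_all _ fun y => Real.abs_cos_le_one _)) _
  have e : ∫ y, scaledStat lam φ x T y ∂μ =
      ∫ y, (scaledStat lam φ x T y - c * Real.cos (T * (y - x))) ∂μ +
        c * ∫ y, Real.cos (T * (y - x)) ∂μ := by
    rw [integral_sub hI1 hI2, integral_const_mul]
    ring
  rw [e, Real.norm_eq_abs]
  refine (abs_add_le _ _).trans (add_le_add abs_integral_le_integral_abs ?_)
  rw [abs_mul, abs_of_nonneg hc0]
  gcongr
  exact abs_integral_cos_mul_sub_le _ _

/-- The difference of the squares is the `L¹`-small difference times a sum bounded by `K + c`; the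
squared cosine then averages to `1/2`. -/
lemma tendsto_integral_scaledStat_sq (hlam : 0 < lam) (hφc : Continuous φ)
    (hφ : ∀ t, ‖φ t‖ ≤ 1) (hlim : Tendsto φ (cocompact ℝ) (𝓝 0)) (hμ : Integrable id μ)
    (hcf : Tendsto (charFun μ) atTop (𝓝 0)) (x : ℝ) :
    Tendsto (fun T => ∫ y, scaledStat lam φ x T y ^ 2 ∂μ) atTop
      (𝓝 ((Real.exp lam / (Real.pi * lam)) ^ 2 * (1 / 2))) := by
  have hpi := Real.pi_pos
  set c := Real.exp lam / (Real.pi * lam) with hc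
  have hc0 : 0 ≤ c := by positivity
  set K := 2 * Real.exp (2 * lam) / (Real.pi * lam) with hK
  have hcf2 : Tendsto (fun T : ℝ => charFun μ (2 * T)) atTop (𝓝 0) :=
    hcf.comp (tendsto_id.const_mul_atTop two_pos)
  have h1 := ((tendsto_integral_abs_scaledStat_sub_cos hlam hφc hφ hlim hμ x).const_mul
    (K + c)).add (hcf2.norm.const_mul (c ^ 2))
  rw [norm_zero, mul_zero, mul_zero, add_zero] at h1
  rw [tendsto_iff_norm_sub_tendsto_zero]
  refine squeeze_zero' (Eventually.of_forall fun _ => norm_nonneg _) ?_ h1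
  filter_upwards [eventually_abs_scaledStat_le hlam hφ x, eventually_ge_atTop 0] with T hT hT0
  have hm := measurable_scaledStat (lam := lam) hφc x hT0
  have hI1 : Integrable (fun y => scaledStat lam φ x T y ^ 2) μ := by
    refine .of_bound (hm.pow_const 2).aestronglyMeasurable (K ^ 2) (ae_of_all _ fun y => ?_)
    rw [norm_pow]
    exact pow_le_pow_left₀ (norm_nonneg _) (hT y) 2
  have hI2 : Integrable (fun y => c ^ 2 * Real.cos (T * (y - x)) ^ 2) μ := by
    refine Integrable.const_mul (.of_bound (by fun_prop) 1 (ae_of_all _ fun y => ?_)) _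
    rw [norm_pow]
    exact pow_le_one₀ (norm_nonneg _) (Real.abs_cos_le_one _)
  have hI3 : Integrable (fun y => |scaledStat lam φ x T y - c * Real.cos (T * (y - x))|) μ :=
    ((Integrable.of_bound hm.aestronglyMeasurable _ (ae_of_all _ hT)).sub
      (Integrable.const_mul (.of_bound (by fun_prop) 1
        (ae_of_all _ fun y => Real.abs_cos_le_one _)) _)).abs
  have e : ∫ y, scaledStat lam φ x T y ^ 2 ∂μ - c ^ 2 * (1 / 2) =
      ∫ y, (scaledStat lam φ x T y ^ 2 - c ^ 2 * Real.cos (T * (y - x)) ^ 2) ∂μ +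
        c ^ 2 * (∫ y, Real.cos (T * (y - x)) ^ 2 ∂μ - 1 / 2) := by
    rw [integral_sub hI1 hI2, integral_const_mul]
    ring
  rw [e, Real.norm_eq_abs]
  refine (abs_add_le _ _).trans (add_le_add (abs_integral_le_integral_abs.trans ?_) ?_)
  · rw [← integral_const_mul]
    refine integral_mono (hI1.sub hI2).abs (hI3.const_mul _) fun y => ?_
    have h2 : |scaledStat lam φ x T y + c * Real.cos (T * (y - x))| ≤ K + c := by
      refine (abs_add_le _ _).trans (add_le_add (hT y) ?_)
      rw [abs_mul, abs_of_nonneg hc0]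
      exact mul_le_of_le_one_right hc0 (Real.abs_cos_le_one _)
    calc |scaledStat lam φ x T y ^ 2 - c ^ 2 * Real.cos (T * (y - x)) ^ 2|
        = |scaledStat lam φ x T y + c * Real.cos (T * (y - x))| *
          |scaledStat lam φ x T y - c * Real.cos (T * (y - x))| := by
          rw [← abs_mul]
          ring_nf
      _ ≤ _ := by gcongr
  · rw [abs_mul, abs_of_nonneg (by positivity)]
    gcongr
    exact abs_integral_cos_sq_sub_half_le _ _

/-- The mean of the linearized statistic, when `φ` and `charFun μ` correspond to each other. -/
lemma integral_linStat (hφc : Continuous φ)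
    (hinv : ∀ t, charFun μ t * invMixCF lam φ t = 1) (x : ℝ) {T : ℝ} (hT : 0 ≤ T) :
    ∫ y, linStat lam φ x T y ∂μ = (1 / (2 * Real.pi * lam)) *
      (∫ t in (-T)..T, Complex.exp (-(Complex.I * t * x))).re := by
  have hTT : -T ≤ T := by linarith
  have hcont : Continuous fun p : ℝ × ℝ =>
      Complex.exp (Complex.I * p.2 * (p.1 - x)) * invMixCF lam φ p.2 :=
    Continuous.mul (by fun_prop) ((continuous_invMixCF lam hφc).comp continuous_snd)
  obtain ⟨C, hC⟩ := isCompact_Icc.exists_bound_of_continuousOn (s := Set.Icc (-T) T)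
    (continuous_invMixCF lam hφc).continuousOn
  have hint : Integrable (fun p : ℝ × ℝ =>
      Complex.exp (Complex.I * p.2 * (p.1 - x)) * invMixCF lam φ p.2)
      (μ.prod (volume.restrict (Set.Ioc (-T) T))) := by
    refine .of_bound hcont.aestronglyMeasurable C ?_
    have hae : ∀ᵐ t ∂(volume.restrict (Set.Ioc (-T) T)), t ∈ Set.Ioc (-T) T :=
      ae_restrict_mem measurableSet_Ioc
    have := Measure.quasiMeasurePreserving_snd (μ := μ) (ν := volume.restrict (Set.Ioc (-T) T))
      |>.ae hae
    filter_upwards [this] with p hp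
    rw [norm_mul, show Complex.I * p.2 * (p.1 - x) = ((p.2 * (p.1 - x) : ℝ) : ℂ) * Complex.I by
      push_cast; ring, Complex.norm_exp_ofReal_mul_I, one_mul]
    exact hC _ ⟨hp.1.le, hp.2⟩
  unfold linStat
  simp only [intervalIntegral.integral_of_le hTT]
  rw [integral_const_mul]
  congr 1
  have hre := Complex.reCLM.integral_comp_comm hint.integral_prod_left
  simp only [Complex.reCLM_apply] at hre
  rw [hre, integral_integral_swap hint]
  congr 2
  funext t
  rw [integral_mul_const]
  have : ∫ y : ℝ, Complex.exp (Complex.I * t * (y - x)) ∂μ =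
      Complex.exp (-(Complex.I * t * x)) * charFun μ t := by
    rw [charFun_apply_real, ← integral_const_mul]
    congr 1
    funext y
    rw [← Complex.exp_add]
    ring_nf
  rw [this, mul_assoc, hinv, mul_one]

end Moments


/-! ### Linearization when the empirical characteristic function is accurate -/

section GoodEvent

variable {lam : ℝ} {φ : ℝ → ℂ} {μ : Measure ℝ}

lemma invMixCF_zero (hφ0 : φ 0 = 1) : invMixCF lam φ 0 = 1 := by
  simp [invMixCF, hφ0]

lemma mem_slitPlane_of_norm_sub_one_le_half {z : ℂ} (hz : ‖z - 1‖ ≤ 1 / 2) :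
    z ∈ Complex.slitPlane := by
  have := Complex.mem_slitPlane_of_norm_lt_one (z := z - 1) (by linarith)
  simpa using this

lemma norm_log_sub_le {z : ℂ} (hz : ‖z - 1‖ ≤ 1 / 2) :
    ‖Complex.log z - (z - 1)‖ ≤ ‖z - 1‖ ^ 2 := by
  have h := Complex.norm_log_one_add_sub_self_le (z := z - 1) (by linarith)
  rw [add_sub_cancel] at h
  refine h.trans ?_
  rw [mul_div_assoc]
  refine mul_le_of_le_one_right (by positivity) ?_
  have : (1 - ‖z - 1‖)⁻¹ ≤ 2 := by
    rw [inv_le_comm₀ (by linarith) two_pos]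
    linarith
  linarith

lemma norm_log_le_one {z : ℂ} (hz : ‖z - 1‖ ≤ 1 / 2) : ‖Complex.log z‖ ≤ 1 := by
  have h := norm_log_sub_le hz
  have h2 : ‖Complex.log z‖ ≤ ‖Complex.log z - (z - 1)‖ + ‖z - 1‖ := by
    simpa using norm_add_le (Complex.log z - (z - 1)) (z - 1)
  nlinarith [norm_nonneg (z - 1)]

/-- If the empirical characteristic function is relatively close to the true one, the
distinguished logarithm is obtained from the principal logarithm of their ratio. -/
lemma isDistLog_of_norm_sub_one_le {s : ℕ → ℝ} {n : ℕ} {h : ℝ} (hh : 0 < h) (hn : n ≠ 0)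
    (hφc : Continuous φ) (hφ0 : φ 0 = 1)
    (hgood : ∀ t ∈ Set.Icc (-(1 / h)) (1 / h),
      ‖empCharFun s n t * invMixCF lam φ t - 1‖ ≤ 1 / 2) :
    IsDistLog (deconvRatio sincKernelFT lam s n h) (1 / h)
      fun t => lam * φ t + Complex.log (empCharFun s n t * invMixCF lam φ t) where
  continuousOn := by
    refine ContinuousOn.add (by fun_prop) (ContinuousOn.clog ?_ fun t ht =>
      mem_slitPlane_of_norm_sub_one_le_half (hgood t ht))
    exact ((continuous_empCharFun s n).mul (continuous_invMixCF lam hφc)).continuousOn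
  exp_eq t ht := by
    have hne : empCharFun s n t * invMixCF lam φ t ≠ 0 :=
      Complex.slitPlane_ne_zero (mem_slitPlane_of_norm_sub_one_le_half (hgood t ht))
    rw [deconvRatio_sinc_of_mem_Icc hh ht, Complex.exp_add, Complex.exp_log hne, mul_left_comm,
      invMixCF, ← Complex.exp_add]
    ring_nf
  zero_eq := by
    rw [deconvRatio_sinc_zero hh hn, empCharFun_zero hn, invMixCF_zero hφ0, hφ0]
    simp

lemma norm_cexp_neg_I_mul (t x : ℝ) : ‖Complex.exp (-(Complex.I * t * x))‖ = 1 := by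
  rw [show -(Complex.I * t * x) = ((-(t * x) : ℝ) : ℂ) * Complex.I by push_cast; ring,
    Complex.norm_exp_ofReal_mul_I]

/-- Exchanging sum and integral identifies the linear term of the logarithm with a sample mean of
independent summands. -/
lemma mean_linStat_eq (hφc : Continuous φ) (s : ℕ → ℝ) (n : ℕ) (x T : ℝ) :
    1 / (n : ℝ) * ∑ j ∈ Finset.range n, linStat lam φ x T (s j) = (1 / (2 * Real.pi * lam)) *
      (∫ t in (-T)..T, Complex.exp (-(Complex.I * t * x)) *
        (empCharFun s n t * invMixCF lam φ t)).re := by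
  have hi (j : ℕ) : IntervalIntegrable (fun t : ℝ =>
      Complex.exp (Complex.I * t * (s j - x)) * invMixCF lam φ t) volume (-T) T :=
    Continuous.intervalIntegrable (by fun_prop) _ _
  have e : (fun t : ℝ => Complex.exp (-(Complex.I * t * x)) *
      (empCharFun s n t * invMixCF lam φ t)) = fun t : ℝ => ((1 / (n : ℝ) : ℝ) : ℂ) *
        ∑ j ∈ Finset.range n, Complex.exp (Complex.I * t * (s j - x)) * invMixCF lam φ t := by
    funext t
    rw [empCharFun, ← Finset.sum_mul]
    have : ∀ j, Complex.exp (Complex.I * t * (s j - x)) =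
        Complex.exp (-(Complex.I * t * x)) * Complex.exp (Complex.I * t * s j) := fun j => by
      rw [← Complex.exp_add]
      ring_nf
    simp only [this, ← Finset.mul_sum]
    push_cast
    ring
  rw [e, intervalIntegral.integral_const_mul, intervalIntegral.integral_finsetSum fun j _ => hi j,
    Complex.re_ofReal_mul, Complex.re_sum]
  unfold linStat
  rw [← Finset.mul_sum]
  ring

/-- The deterministic part of the estimator. -/
noncomputable def biasTerm (lam : ℝ) (φ : ℝ → ℂ) (x T : ℝ) : ℝ :=
  (1 / (2 * Real.pi * lam)) *
    (∫ t in (-T)..T, Complex.exp (-(Complex.I * t * x)) * (lam * φ t)).re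

/-- Integrability of `φ` makes the bound independent of `T`. -/
lemma abs_biasTerm_le (hlam : 0 < lam) (hφc : Continuous φ) (hφi : Integrable φ) (x : ℝ) {T : ℝ}
    (hT : 0 ≤ T) : |biasTerm lam φ x T| ≤ 1 / (2 * Real.pi) * ∫ t, ‖φ t‖ := by
  have hpi := Real.pi_pos
  have h1 : ‖∫ t in (-T)..T, Complex.exp (-(Complex.I * t * x)) * (lam * φ t)‖ ≤
      ∫ t in (-T)..T, lam * ‖φ t‖ := by
    refine intervalIntegral.norm_integral_le_of_norm_le (by linarith) (ae_of_all _ fun t _ => ?_)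
      (Continuous.intervalIntegrable (by fun_prop) _ _)
    rw [norm_mul, norm_cexp_neg_I_mul, one_mul, norm_mul, Complex.norm_real,
      Real.norm_of_nonneg hlam.le]
  have h2 : ∫ t in (-T)..T, lam * ‖φ t‖ ≤ lam * ∫ t, ‖φ t‖ := by
    rw [intervalIntegral.integral_const_mul, intervalIntegral.integral_of_le (by linarith)]
    exact mul_le_mul_of_nonneg_left (setIntegral_le_integral hφi.norm
      (ae_of_all _ fun _ => norm_nonneg _)) hlam.le
  rw [biasTerm, abs_mul, abs_of_nonneg (by positivity)]
  calc 1 / (2 * Real.pi * lam) *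
        |(∫ t in (-T)..T, Complex.exp (-(Complex.I * t * x)) * (lam * φ t)).re|
      ≤ 1 / (2 * Real.pi * lam) * (lam * ∫ t, ‖φ t‖) := by
        gcongr
        exact (Complex.abs_re_le_norm _).trans (h1.trans h2)
    _ = _ := by field_simp

/-- Dividing by the true characteristic function magnifies errors by at most `exp(2λ) exp(T²/2)`;
this fixes the accuracy demanded of the empirical one. -/
lemma norm_ratio_sub_one_le (hlam : 0 ≤ lam) (hφ : ∀ t, ‖φ t‖ ≤ 1)
    (hinv : ∀ t, charFun μ t * invMixCF lam φ t = 1) {T t : ℝ} (ht : t ∈ Set.Icc (-T) T) (z : ℂ) :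
    ‖z * invMixCF lam φ t - 1‖ ≤
      Real.exp (2 * lam) * Real.exp (T ^ 2 / 2) * ‖z - charFun μ t‖ := by
  rw [← hinv t, ← sub_mul, norm_mul, mul_comm]
  gcongr
  refine (norm_invMixCF_le hlam (hφ t)).trans ?_
  have : t ^ 2 ≤ T ^ 2 := sq_le_sq' ht.1 ht.2
  gcongr

/-- Uniform closeness of the empirical characteristic function bounds the estimator. -/
lemma abs_plugInEstimator_le (hlam : 0 < lam) (hφc : Continuous φ)
    (hφi : Integrable φ) (hφ0 : φ 0 = 1) {s : ℕ → ℝ} {n : ℕ} (hn : n ≠ 0)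
    {h : ℝ} (hh : 0 < h) (x d : ℝ)
    (hgood : ∀ t ∈ Set.Icc (-(1 / h)) (1 / h),
      ‖empCharFun s n t * invMixCF lam φ t - 1‖ ≤ 1 / 2) :
    |plugInEstimator sincKernelFT lam s n h x d| ≤
      1 / (2 * Real.pi * lam) * (lam * (∫ t, ‖φ t‖) + 2 * (1 / h)) := by
  have hpi := Real.pi_pos
  have hL := isDistLog_of_norm_sub_one_le (lam := lam) hh hn hφc hφ0 hgood
  rw [plugInEstimator_eq_of_isDistLog hh x d hL]
  set T := 1 / h
  have hT : 0 ≤ T := by positivity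
  have h1 : ‖∫ t in (-T)..T, Complex.exp (-(Complex.I * t * x)) *
      (lam * φ t + Complex.log (empCharFun s n t * invMixCF lam φ t))‖ ≤
      ∫ t in (-T)..T, (lam * ‖φ t‖ + 1) := by
    refine intervalIntegral.norm_integral_le_of_norm_le (by linarith) (ae_of_all _ fun t ht => ?_)
      (Continuous.intervalIntegrable (by fun_prop) _ _)
    rw [norm_mul, norm_cexp_neg_I_mul, one_mul]
    refine (norm_add_le _ _).trans ?_
    rw [norm_mul, Complex.norm_real, Real.norm_of_nonneg hlam.le]
    gcongr
    exact norm_log_le_one (hgood t ⟨ht.1.le, ht.2⟩)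
  have h2 : ∫ t in (-T)..T, (lam * ‖φ t‖ + 1) ≤ lam * (∫ t, ‖φ t‖) + 2 * T := by
    rw [intervalIntegral.integral_add (Continuous.intervalIntegrable (by fun_prop) _ _)
      (Continuous.intervalIntegrable (by fun_prop) _ _), intervalIntegral.integral_const_mul,
      intervalIntegral.integral_of_le (by linarith), intervalIntegral.integral_const]
    have := setIntegral_le_integral (s := Set.Ioc (-T) T) hφi.norm
      (ae_of_all _ fun _ => norm_nonneg _)
    have := mul_le_mul_of_nonneg_left this hlam.le
    rw [smul_eq_mul, mul_one]
    linarith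
  rw [abs_mul, abs_of_nonneg (by positivity)]
  gcongr
  exact (Complex.abs_re_le_norm _).trans (h1.trans h2)

/-- Uniform closeness of the empirical characteristic function linearizes the estimator. -/
lemma abs_plugInEstimator_sub_linear_le [IsProbabilityMeasure μ] (hlam : 0 < lam) (hφc : Continuous φ)
    (hφ : ∀ t, ‖φ t‖ ≤ 1) (hφ0 : φ 0 = 1)
    (hinv : ∀ t, charFun μ t * invMixCF lam φ t = 1) {s : ℕ → ℝ} {n : ℕ} (hn : n ≠ 0)
    {h : ℝ} (hh : 0 < h) (x d : ℝ)
    (hgood : ∀ t ∈ Set.Icc (-(1 / h)) (1 / h),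
      ‖empCharFun s n t * invMixCF lam φ t - 1‖ ≤ 1 / 2) :
    |plugInEstimator sincKernelFT lam s n h x d - (biasTerm lam φ x (1 / h) +
      (1 / (n : ℝ) * ∑ j ∈ Finset.range n, linStat lam φ x (1 / h) (s j) -
        ∫ y, linStat lam φ x (1 / h) y ∂μ))| ≤
      1 / (2 * Real.pi * lam) * (Real.exp (4 * lam) * Real.exp ((1 / h) ^ 2) *
        ∫ t in (-(1 / h))..(1 / h), ‖empCharFun s n t - charFun μ t‖ ^ 2) := by
  have hpi := Real.pi_pos
  have hL := isDistLog_of_norm_sub_one_le (lam := lam) hh hn hφc hφ0 hgood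
  rw [plugInEstimator_eq_of_isDistLog hh x d hL]
  set T := 1 / h
  have hT : 0 ≤ T := by positivity
  have hTT : -T ≤ T := by linarith
  -- The sample mean contributes the ratio `r` and its expectation contributes the `1` in `r - 1`.
  rw [mean_linStat_eq hφc, integral_linStat hφc hinv x hT, biasTerm, ← mul_sub, ← mul_add,
    ← mul_sub, ← Complex.sub_re, ← Complex.add_re, ← Complex.sub_re, abs_mul,
    abs_of_nonneg (by positivity)]
  gcongr
  refine (Complex.abs_re_le_norm _).trans ?_
  have hE := continuous_empCharFun s n
  have hLi : IntervalIntegrable (fun t => Complex.exp (-(Complex.I * t * x)) *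
      (lam * φ t + Complex.log (empCharFun s n t * invMixCF lam φ t))) volume (-T) T := by
    refine ContinuousOn.intervalIntegrable ?_
    rw [Set.uIcc_of_le hTT]
    exact ContinuousOn.mul (by fun_prop) hL.continuousOn
  rw [← intervalIntegral.integral_sub (Continuous.intervalIntegrable (by fun_prop) _ _)
    (Continuous.intervalIntegrable (by fun_prop) _ _),
    ← intervalIntegral.integral_add (Continuous.intervalIntegrable (by fun_prop) _ _)
    (Continuous.intervalIntegrable (by fun_prop) _ _), ← intervalIntegral.integral_sub hLi
    (Continuous.intervalIntegrable (by fun_prop) _ _), ← intervalIntegral.integral_const_mul]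
  refine intervalIntegral.norm_integral_le_of_norm_le hTT (ae_of_all _ fun t ht => ?_)
    (Continuous.intervalIntegrable (by fun_prop) _ _)
  have ht' : t ∈ Set.Icc (-T) T := ⟨ht.1.le, ht.2⟩
  set r := empCharFun s n t * invMixCF lam φ t with hr
  -- The integrand of the remainder reduces to `log r - (r - 1)`, which is quadratic in `r - 1`.
  have e : Complex.exp (-(Complex.I * t * x)) * (lam * φ t + Complex.log r) -
      (Complex.exp (-(Complex.I * t * x)) * (lam * φ t) + (Complex.exp (-(Complex.I * t * x)) * r -
        Complex.exp (-(Complex.I * t * x)))) =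
      Complex.exp (-(Complex.I * t * x)) * (Complex.log r - (r - 1)) := by ring
  rw [e, norm_mul, norm_cexp_neg_I_mul, one_mul]
  refine (norm_log_sub_le (hgood t ht')).trans ?_
  calc ‖r - 1‖ ^ 2 ≤ (Real.exp (2 * lam) * Real.exp (T ^ 2 / 2) *
        ‖empCharFun s n t - charFun μ t‖) ^ 2 := by
        gcongr
        exact norm_ratio_sub_one_le hlam.le hφ hinv ht' _
    _ = _ := by
        rw [mul_pow, mul_pow, ← Real.exp_nat_mul, ← Real.exp_nat_mul]
        ring_nf

end GoodEvent

/-! ### Integrated mean square error -/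

section SecondMoment

variable {Ω : Type*} [MeasurableSpace Ω] {P : Measure Ω} [IsProbabilityMeasure P]
  {μ : Measure ℝ} [IsProbabilityMeasure μ] {X : ℕ → Ω → ℝ}

lemma norm_empCharFun_le_one (s : ℕ → ℝ) (n : ℕ) (t : ℝ) : ‖empCharFun s n t‖ ≤ 1 := by
  rcases eq_or_ne n 0 with rfl | hn
  · simp [empCharFun]
  rw [empCharFun, norm_mul, norm_div, norm_one, Complex.norm_natCast]
  have : ‖∑ j ∈ Finset.range n, Complex.exp (Complex.I * t * s j)‖ ≤ n := by
    refine (norm_sum_le_of_le _ (f := fun j => Complex.exp (Complex.I * t * s j))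
      (n := fun _ => 1) fun j _ => ?_).trans (by simp)
    rw [show Complex.I * t * s j = ((t * s j : ℝ) : ℂ) * Complex.I by push_cast; ring,
      Complex.norm_exp_ofReal_mul_I]
  have hn' : 0 < (n : ℝ) := by positivity
  rw [one_div_mul_eq_div, div_le_one hn']
  exact this

lemma integrable_prod_norm_empCharFun_sub_sq (hXm : ∀ i, Measurable (X i)) (n : ℕ) (T : ℝ) :
    Integrable (fun p : Ω × ℝ => ‖empCharFun (fun i => X i p.1) n p.2 - charFun μ p.2‖ ^ 2)
      (P.prod (volume.restrict (Set.Ioc (-T) T))) := by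
  have hm : Measurable fun p : Ω × ℝ => empCharFun (fun i => X i p.1) n p.2 := by
    unfold empCharFun
    fun_prop
  have hm2 : Measurable fun p : Ω × ℝ => charFun μ p.2 := measurable_charFun.comp measurable_snd
  refine .of_bound ((hm.sub hm2).norm.pow_const 2).aestronglyMeasurable (2 ^ 2)
    (ae_of_all _ fun p => ?_)
  rw [norm_pow, norm_norm]
  gcongr
  refine (norm_sub_le _ _).trans ?_
  linarith [norm_empCharFun_le_one (fun i => X i p.1) n p.2, norm_charFun_le_one (μ := μ) p.2]

/-- The mean integrated square error of the empirical characteristic function on `[-T, T]`. -/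
lemma integral_integral_norm_empCharFun_sub_sq_le
    (hXm : ∀ i, Measurable (X i)) (hind : iIndepFun X P) (hlaw : ∀ i, P.map (X i) = μ)
    {n : ℕ} (hn : n ≠ 0) {T : ℝ} (hT : 0 ≤ T) :
    Integrable (fun ω => ∫ t in (-T)..T, ‖empCharFun (fun i => X i ω) n t - charFun μ t‖ ^ 2) P ∧
    ∫ ω, (∫ t in (-T)..T, ‖empCharFun (fun i => X i ω) n t - charFun μ t‖ ^ 2) ∂P ≤
      2 * T / n := by
  have hint := integrable_prod_norm_empCharFun_sub_sq (P := P) (μ := μ) hXm n T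
  simp only [intervalIntegral.integral_of_le (by linarith : -T ≤ T)]
  refine ⟨hint.integral_prod_left, ?_⟩
  rw [integral_integral_swap hint]
  calc ∫ t in Set.Ioc (-T) T, ∫ ω, ‖empCharFun (fun i => X i ω) n t - charFun μ t‖ ^ 2 ∂P
      ≤ ∫ t in Set.Ioc (-T) T, 1 / (n : ℝ) :=
        integral_mono hint.integral_prod_right (integrable_const _)
          fun t => integral_norm_empCharFun_sub_sq_le hXm hind hlaw hn t
    _ = 2 * T / n := by
        rw [setIntegral_const, Real.volume_real_Ioc_of_le (by linarith), smul_eq_mul]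
        ring

end SecondMoment


/-! ### Orders of magnitude -/

section Rates

lemma tendsto_log_natCast : Tendsto (fun n : ℕ => Real.log n) atTop atTop :=
  Real.tendsto_log_atTop.comp tendsto_natCast_atTop_atTop

/-- The cut-off `1 / h` tends to infinity more slowly than `√(log n)`. -/
lemma tendsto_one_div_bandwidth {h : ℕ → ℝ} {β : ℝ} (hβ0 : 0 < β) (hβ : β < 1 / 2)
    (hh : h ~[atTop] fun n : ℕ => Real.log n ^ (-β)) :
    Tendsto (fun n => 1 / h n) atTop atTop ∧
      Tendsto (fun n => (1 / h n) ^ 2 / Real.log n) atTop (𝓝 0) := by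
  have hlog := tendsto_log_natCast
  have hT : (fun n => 1 / h n) ~[atTop] fun n : ℕ => Real.log n ^ β := by
    have h1 := hh.inv
    refine (h1.congr_left (Eventually.of_forall fun n => (one_div _).symm)).congr_right ?_
    filter_upwards [hlog.eventually_ge_atTop 0] with n hn
    simp only [Pi.inv_apply, Real.rpow_neg hn, inv_inv]
  refine ⟨hT.symm.tendsto_atTop ((tendsto_rpow_atTop hβ0).comp hlog), ?_⟩
  have h2 : (fun n => (1 / h n) ^ 2 / Real.log n) ~[atTop]
      fun n : ℕ => (Real.log n ^ β) ^ 2 / Real.log n := (hT.pow 2).div IsEquivalent.refl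
  refine h2.symm.tendsto_nhds ?_
  -- The quotient is equivalent to `(log n)^(2β - 1)`; the condition `β < 1/2` makes this exponent
  -- negative.
  have h3 := (tendsto_rpow_neg_atTop (by linarith : 0 < 1 - 2 * β)).comp hlog
  refine h3.congr' ?_
  filter_upwards [hlog.eventually_gt_atTop 0] with n hn
  simp only [Function.comp]
  rw [← Real.rpow_natCast, ← Real.rpow_mul hn.le, ← Real.rpow_sub_one hn.ne']
  congr 1
  push_cast
  ring

variable {T : ℕ → ℝ}

/-- Eventually `T² ≤ (log n)/2`. Any power of `n` below `1/2` would serve in place of `1/4`. -/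
lemma eventually_exp_sq_half_le (hT2 : Tendsto (fun n => T n ^ 2 / Real.log n) atTop (𝓝 0)) :
    ∀ᶠ n : ℕ in atTop, T n ^ 2 ≤ Real.log n ∧ Real.exp (T n ^ 2 / 2) ≤ (n : ℝ) ^ (1 / 4 : ℝ) := by
  filter_upwards [hT2.eventually (eventually_le_nhds (by norm_num : (0 : ℝ) < 1 / 2)),
    tendsto_log_natCast.eventually_gt_atTop 0, eventually_gt_atTop 0] with n hn hlog hn0
  rw [div_le_iff₀ hlog] at hn
  refine ⟨by linarith, ?_⟩
  rw [Real.rpow_def_of_pos (by exact_mod_cast hn0)]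
  exact Real.exp_le_exp.2 (by linarith)

lemma tendsto_log_div_rpow {s : ℝ} (hs : 0 < s) :
    Tendsto (fun n : ℕ => Real.log n / (n : ℝ) ^ s) atTop (𝓝 0) :=
  (isLittleO_log_rpow_atTop hs).tendsto_div_nhds_zero.comp tendsto_natCast_atTop_atTop

/-- The factor `2T/n` is the integrated mean square error and `exp(T²)` the squared magnification.
The product is `2K T² exp(T²/2)/√n`, at most a multiple of `log n / n^(1/4)`. -/
lemma tendsto_quadratic_remainder (hT : Tendsto T atTop atTop)
    (hT2 : Tendsto (fun n => T n ^ 2 / Real.log n) atTop (𝓝 0)) (K : ℝ) :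
    Tendsto (fun n : ℕ => √n * (T n * Real.exp (-T n ^ 2 / 2)) *
      (K * Real.exp (T n ^ 2) * (2 * T n / n))) atTop (𝓝 0) := by
  have h1 := (tendsto_log_div_rpow (by norm_num : (0 : ℝ) < 1 / 4)).const_mul (2 * |K|)
  rw [mul_zero] at h1
  refine squeeze_zero_norm' ?_ h1
  filter_upwards [eventually_exp_sq_half_le hT2, hT.eventually_ge_atTop 0, eventually_gt_atTop 0]
    with n ⟨hn1, hn2⟩ hT0 hn0
  have hn' : 0 < (n : ℝ) := by exact_mod_cast hn0
  have hs : √(n : ℝ) = (n : ℝ) ^ (1 / 4 : ℝ) * (n : ℝ) ^ (1 / 4 : ℝ) := by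
    rw [← Real.rpow_add hn', Real.sqrt_eq_rpow]
    norm_num
  set q := (n : ℝ) ^ (1 / 4 : ℝ) with hq
  have hq0 : 0 < q := by positivity
  have hn4 : (n : ℝ) = q * q * (q * q) := by
    rw [← hs, Real.mul_self_sqrt hn'.le]
  have hexp : Real.exp (-T n ^ 2 / 2) * Real.exp (T n ^ 2) = Real.exp (T n ^ 2 / 2) := by
    rw [← Real.exp_add]
    ring_nf
  have e : √(n : ℝ) * (T n * Real.exp (-T n ^ 2 / 2)) *
      (K * Real.exp (T n ^ 2) * (2 * T n / n)) =
      K * (2 * T n ^ 2 * Real.exp (T n ^ 2 / 2) / (q * q)) := by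
    rw [← hexp, hs, hn4]
    field_simp
  rw [e, norm_mul, Real.norm_eq_abs, Real.norm_of_nonneg (by positivity)]
  calc |K| * (2 * T n ^ 2 * Real.exp (T n ^ 2 / 2) / (q * q))
      ≤ |K| * (2 * Real.log n * q / (q * q)) := by gcongr
    _ = 2 * |K| * (Real.log n / q) := by field_simp

/-- An upper bound for the probability that the empirical characteristic function of `n`
observations deviates by more than `ε` from its mean somewhere on `[-T, T]`. -/
noncomputable def deviationBound (m T ε : ℝ) (n : ℕ) : ℝ :=
  m / n + (4 * T * (n + m) / ε + 2) * (4 * Real.exp (-(n * ε ^ 2 / 32)))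

lemma deviationBound_nonneg {m T ε : ℝ} (hm : 0 ≤ m) (hT : 0 ≤ T) (hε : 0 ≤ ε) (n : ℕ) :
    0 ≤ deviationBound m T ε n := by
  unfold deviationBound
  positivity

/-- The accuracy at which the empirical characteristic function determines the logarithm. -/
noncomputable def accuracy (lam T : ℝ) : ℝ := Real.exp (-(2 * lam)) * Real.exp (-T ^ 2 / 2) / 2

lemma accuracy_pos (lam T : ℝ) : 0 < accuracy lam T := by
  unfold accuracy
  positivity

/-- The inverse accuracy is a multiple of `exp(T²/2) ≤ n^(1/4)`, so the number of grid points is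
polynomial in `n`, while the Hoeffding exponent is at least a multiple of `√n`. The Markov term
`m/n` dominates. -/
lemma eventually_deviationBound_le {lam m : ℝ} (hm : 0 ≤ m) (hT : Tendsto T atTop atTop)
    (hT2 : Tendsto (fun n => T n ^ 2 / Real.log n) atTop (𝓝 0)) :
    ∀ᶠ n : ℕ in atTop, deviationBound m (T n) (accuracy lam (T n)) n ≤ (m + 1) / n := by
  set D := 8 * Real.exp (2 * lam) * (1 + m) + 2 with hD
  have hD0 : 0 < D := by positivity
  set κ := Real.exp (-(4 * lam)) / 128 with hκ
  have hκ0 : 0 < κ := by positivity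
  -- The power `√n ^ 8 = n⁴` comes from `n³` bounding the grid size and one more `n` from the target
  -- `1/n`.
  have hlim : Tendsto (fun n : ℕ => 4 * D * (√(n : ℝ) ^ 8 * Real.exp (-(κ * √(n : ℝ))))) atTop
      (𝓝 0) := by
    have h1 := Real.tendsto_pow_mul_exp_neg_atTop_nhds_zero 8
    have h2 : Tendsto (fun n : ℕ => κ * √(n : ℝ)) atTop atTop :=
      (Real.tendsto_sqrt_atTop.comp tendsto_natCast_atTop_atTop).const_mul_atTop hκ0
    have h3 := (h1.comp h2).const_mul (4 * D / κ ^ 8)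
    rw [mul_zero] at h3
    refine h3.congr fun n => ?_
    simp only [Function.comp, mul_pow]
    field_simp
  filter_upwards [eventually_exp_sq_half_le hT2, hT.eventually_ge_atTop 1, eventually_ge_atTop 1,
    hlim.eventually (eventually_le_nhds one_pos)] with n ⟨hn1, hn2⟩ hT1 hn0 hl
  have hn' : 1 ≤ (n : ℝ) := by exact_mod_cast hn0
  have hnpos : 0 < (n : ℝ) := by linarith
  have hTn : T n ≤ n := by
    have h1 : Real.log n ≤ n := (Real.log_le_sub_one_of_pos hnpos).trans (by linarith)
    nlinarith
  have hEn : Real.exp (T n ^ 2 / 2) ≤ n := by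
    refine hn2.trans ?_
    calc (n : ℝ) ^ (1 / 4 : ℝ) ≤ (n : ℝ) ^ (1 : ℝ) :=
          Real.rpow_le_rpow_of_exponent_le hn' (by norm_num)
      _ = n := Real.rpow_one _
  have hE2 : Real.exp (T n ^ 2 / 2) ^ 2 ≤ √(n : ℝ) := by
    calc Real.exp (T n ^ 2 / 2) ^ 2 ≤ ((n : ℝ) ^ (1 / 4 : ℝ)) ^ 2 := by gcongr
      _ = √(n : ℝ) := by
        rw [← Real.rpow_natCast, ← Real.rpow_mul hnpos.le, Real.sqrt_eq_rpow]
        norm_num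
  set E := Real.exp (T n ^ 2 / 2) with hE
  have hE0 : 0 < E := Real.exp_pos _
  have hacc : accuracy lam (T n) = 1 / (2 * Real.exp (2 * lam) * E) := by
    rw [accuracy, hE, Real.exp_neg, neg_div, Real.exp_neg]
    field_simp
  have hs0 : 0 < √(n : ℝ) := Real.sqrt_pos.2 hnpos
  have hss : √(n : ℝ) * √(n : ℝ) = n := Real.mul_self_sqrt hnpos.le
  have hb1 : 4 * T n * (n + m) / accuracy lam (T n) + 2 ≤ D * n ^ 3 := by
    rw [hacc, div_div_eq_mul_div, div_one]
    have h1 : (n : ℝ) + m ≤ (1 + m) * n := by nlinarith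
    have h2 : 1 ≤ (n : ℝ) ^ 3 := one_le_pow₀ hn'
    calc 4 * T n * (n + m) * (2 * Real.exp (2 * lam) * E) + 2
        ≤ 4 * n * ((1 + m) * n) * (2 * Real.exp (2 * lam) * n) + 2 * n ^ 3 := by
          gcongr
          linarith
      _ = D * n ^ 3 := by rw [hD]; ring
  have hb2 : κ * √(n : ℝ) ≤ n * accuracy lam (T n) ^ 2 / 32 := by
    have h4 : Real.exp (-(4 * lam)) = 1 / Real.exp (2 * lam) ^ 2 := by
      rw [Real.exp_neg, ← Real.exp_nat_mul, one_div]
      push_cast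
      ring_nf
    have e : n * accuracy lam (T n) ^ 2 / 32 = κ * (n / E ^ 2) := by
      rw [hacc, hκ, h4]
      field_simp
      norm_num
    rw [e]
    gcongr
    rw [le_div_iff₀ (by positivity)]
    calc √(n : ℝ) * E ^ 2 ≤ √(n : ℝ) * √(n : ℝ) := by gcongr
      _ = n := hss
  have hb3 : (4 * T n * (n + m) / accuracy lam (T n) + 2) *
      (4 * Real.exp (-(n * accuracy lam (T n) ^ 2 / 32))) ≤ 1 / n := by
    rw [le_div_iff₀ hnpos]
    calc (4 * T n * (n + m) / accuracy lam (T n) + 2) *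
          (4 * Real.exp (-(n * accuracy lam (T n) ^ 2 / 32))) * n
        ≤ D * n ^ 3 * (4 * Real.exp (-(κ * √(n : ℝ)))) * n := by gcongr
      _ = 4 * D * (√(n : ℝ) ^ 8 * Real.exp (-(κ * √(n : ℝ)))) := by
          have : √(n : ℝ) ^ 8 = (n : ℝ) ^ 4 := by
            calc √(n : ℝ) ^ 8 = (√(n : ℝ) * √(n : ℝ)) ^ 4 := by ring
              _ = _ := by rw [hss]
          rw [this]
          ring
      _ ≤ 1 := hl
  rw [deviationBound, add_div]
  gcongr

/-- `K₁` stands for the deterministic term and `K₂` for the linear part, whose rescaled size is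
already bounded. The normalization is at most `√n`, the truncated estimator at most `C log n`, and
the probability of order `1/n`. -/
lemma tendsto_bad_event_contribution {lam m C K₁ K₂ : ℝ} (hm : 0 ≤ m) (hC : 0 ≤ C) (hK₁ : 0 ≤ K₁)
    (hK₂ : 0 ≤ K₂) (hT : Tendsto T atTop atTop)
    (hT2 : Tendsto (fun n => T n ^ 2 / Real.log n) atTop (𝓝 0)) :
    Tendsto (fun n : ℕ => (√n * (T n * Real.exp (-T n ^ 2 / 2)) * (C * Real.log n + K₁) + √n * K₂) *
      deviationBound m (T n) (accuracy lam (T n)) n) atTop (𝓝 0) := by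
  have hlim : Tendsto (fun n : ℕ => (m + 1) * (C * (Real.log n / (n : ℝ) ^ (1 / 2 : ℝ)) +
      (K₁ + K₂) * (√(n : ℝ))⁻¹)) atTop (𝓝 ((m + 1) * (C * 0 + (K₁ + K₂) * 0))) :=
    (((tendsto_log_div_rpow (by norm_num)).const_mul C).add
      ((tendsto_inv_atTop_zero.comp (Real.tendsto_sqrt_atTop.comp
        tendsto_natCast_atTop_atTop)).const_mul _)).const_mul _
  simp only [mul_zero, add_zero] at hlim
  have hw := (tendsto_pow_mul_exp_neg_sq_half 1).comp hT
  refine squeeze_zero' ?_ ?_ hlim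
  · filter_upwards [hT.eventually_ge_atTop 0] with n hT0
    have h1 : 0 ≤ Real.log n := Real.log_natCast_nonneg n
    have h2 := deviationBound_nonneg hm hT0 (accuracy_pos lam (T n)).le n
    positivity
  · filter_upwards [eventually_deviationBound_le (lam := lam) hm hT hT2, eventually_gt_atTop 0,
      hw.eventually (eventually_le_nhds one_pos), hT.eventually_ge_atTop 0] with n hn hn0 hw1 hT0
    simp only [Function.comp, pow_one] at hw1
    have hnpos : 0 < (n : ℝ) := by exact_mod_cast hn0
    have hs0 : 0 < √(n : ℝ) := Real.sqrt_pos.2 hnpos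
    have hss : √(n : ℝ) * √(n : ℝ) = n := Real.mul_self_sqrt hnpos.le
    have hlog : 0 ≤ Real.log n := Real.log_natCast_nonneg n
    have hdev := deviationBound_nonneg hm hT0 (accuracy_pos lam (T n)).le n
    calc (√n * (T n * Real.exp (-T n ^ 2 / 2)) * (C * Real.log n + K₁) + √n * K₂) *
          deviationBound m (T n) (accuracy lam (T n)) n
        ≤ (√n * 1 * (C * Real.log n + K₁) + √n * K₂) * ((m + 1) / n) := by gcongr
      _ = _ := by
          have : √(n : ℝ) / n = (√(n : ℝ))⁻¹ := by
            rw [div_eq_iff hnpos.ne', inv_mul_eq_div, eq_div_iff hs0.ne', hss]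
          rw [← Real.sqrt_eq_rpow, div_eq_mul_inv (Real.log n), ← this]
          ring

end Rates


/-! ### Asymptotic normality of the truncated estimator -/

section Main

variable {Ω : Type*} [MeasurableSpace Ω] {P : Measure Ω} [IsProbabilityMeasure P]
  {μ : Measure ℝ} {X : ℕ → Ω → ℝ} {lam : ℝ} {φ : ℝ → ℂ}

lemma measurable_truncEstimator (hXm : ∀ i, Measurable (X i)) {d : Ω → ℝ} (hd : Measurable d)
    (n : ℕ) {h : ℝ} (hh : 0 < h) (x M : ℝ) :
    Measurable fun ω => truncEstimator sincKernelFT lam (fun i => X i ω) n h x (d ω) M :=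
  (measurable_const.min (measurable_plugInEstimator hXm hd lam n hh x)).max measurable_const

lemma abs_truncEstimator_le {phiW : ℝ → ℂ} {s : ℕ → ℝ} {n : ℕ} {h x d M : ℝ} (hM : 0 ≤ M) :
    |truncEstimator phiW lam s n h x d M| ≤ M := by
  rw [truncEstimator, abs_le]
  exact ⟨le_max_right _ _, max_le (min_le_left _ _) (by linarith)⟩

lemma truncEstimator_eq_of_abs_le {phiW : ℝ → ℂ} {s : ℕ → ℝ} {n : ℕ} {h x d M : ℝ}
    (hM : |plugInEstimator phiW lam s n h x d| ≤ M) :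
    truncEstimator phiW lam s n h x d M = plugInEstimator phiW lam s n h x d := by
  obtain ⟨h1, h2⟩ := abs_le.1 hM
  rw [truncEstimator, min_eq_right h2, max_eq_left h1]

/-- The centred linearization of the estimator. -/
noncomputable def linearPart (lam : ℝ) (φ : ℝ → ℂ) (μ : Measure ℝ) (x T : ℝ) (n : ℕ)
    (s : ℕ → ℝ) : ℝ :=
  1 / (n : ℝ) * ∑ j ∈ Finset.range n, linStat lam φ x T (s j) - ∫ y, linStat lam φ x T y ∂μ

lemma measurable_linearPart (hXm : ∀ i, Measurable (X i)) (hφc : Continuous φ) (x : ℝ) {T : ℝ}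
    (hT : 0 ≤ T) (n : ℕ) : Measurable fun ω => linearPart lam φ μ x T n fun i => X i ω := by
  unfold linearPart
  exact ((Finset.measurable_fun_sum _ fun j _ =>
    (measurable_linStat lam hφc x hT).comp (hXm j)).const_mul _).sub_const _

lemma abs_linearPart_le [IsProbabilityMeasure μ] {x T K : ℝ} (hK : ∀ y, |linStat lam φ x T y| ≤ K) (n : ℕ) (s : ℕ → ℝ) :
    |linearPart lam φ μ x T n s| ≤ 2 * K := by
  have hK0 : 0 ≤ K := (abs_nonneg _).trans (hK 0)
  have h1 : |1 / (n : ℝ) * ∑ j ∈ Finset.range n, linStat lam φ x T (s j)| ≤ K := by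
    rcases eq_or_ne n 0 with rfl | hn
    · simpa using hK0
    have hn' : 0 < (n : ℝ) := by positivity
    rw [abs_mul, abs_of_nonneg (by positivity), one_div_mul_eq_div, div_le_iff₀ hn']
    refine (Finset.abs_sum_le_sum_abs _ _).trans ((Finset.sum_le_sum fun j _ => hK (s j)).trans ?_)
    rw [Finset.sum_const, Finset.card_range, nsmul_eq_mul, mul_comm]
  have h2 : |∫ y, linStat lam φ x T y ∂μ| ≤ K := by
    have : ‖∫ y, linStat lam φ x T y ∂μ‖ ≤ K * μ.real Set.univ :=
      norm_integral_le_of_norm_le_const (ae_of_all _ hK)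
    simpa using this
  unfold linearPart
  refine (abs_sub _ _).trans ?_
  linarith

lemma integral_linearPart (hXm : ∀ i, Measurable (X i)) (hlaw : ∀ i, P.map (X i) = μ)
    (hφc : Continuous φ) {x T K : ℝ} (hT : 0 ≤ T) (hK : ∀ y, |linStat lam φ x T y| ≤ K) {n : ℕ}
    (hn : n ≠ 0) : ∫ ω, linearPart lam φ μ x T n (fun i => X i ω) ∂P = 0 := by
  have hm := measurable_linStat lam hφc x hT
  have hi (j : ℕ) : Integrable (fun ω => linStat lam φ x T (X j ω)) P :=
    .of_bound (hm.comp (hXm j)).aestronglyMeasurable K (ae_of_all _ fun ω => hK _)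
  have hj (j : ℕ) : ∫ ω, linStat lam φ x T (X j ω) ∂P = ∫ y, linStat lam φ x T y ∂μ := by
    rw [← hlaw j, integral_map (hXm j).aemeasurable hm.aestronglyMeasurable]
  have hn' : (n : ℝ) ≠ 0 := by exact_mod_cast hn
  unfold linearPart
  rw [integral_sub ((integrable_finsetSum _ fun j _ => hi j).const_mul _) (integrable_const _),
    integral_const_mul, integral_finsetSum _ fun j _ => hi j]
  simp only [hj, Finset.sum_const, Finset.card_range, nsmul_eq_mul, integral_const,
    probReal_univ, one_smul]
  field_simp
  ring

/-- The mean error of the linearization of the truncated estimator. -/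
lemma integral_abs_truncEstimator_sub_linear_le [IsProbabilityMeasure μ]
    (hXm : ∀ i, Measurable (X i)) (hind : iIndepFun X P) (hlaw : ∀ i, P.map (X i) = μ)
    (hμ : Integrable id μ) (hlam : 0 < lam) (hφc : Continuous φ) (hφ : ∀ t, ‖φ t‖ ≤ 1)
    (hφi : Integrable φ) (hφ0 : φ 0 = 1) (hinv : ∀ t, charFun μ t * invMixCF lam φ t = 1)
    {n : ℕ} (hn : n ≠ 0) {h : ℝ} (hh : 0 < h) (x : ℝ) (d : Ω → ℝ) {M K : ℝ}
    (hM : 1 / (2 * Real.pi * lam) * (lam * (∫ t, ‖φ t‖) + 2 * (1 / h)) ≤ M)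
    (hK : ∀ y, |linStat lam φ x (1 / h) y| ≤ K) :
    ∫ ω, |truncEstimator sincKernelFT lam (fun i => X i ω) n h x (d ω) M -
      biasTerm lam φ x (1 / h) - linearPart lam φ μ x (1 / h) n (fun i => X i ω)| ∂P ≤
      1 / (2 * Real.pi * lam) * Real.exp (4 * lam) * Real.exp ((1 / h) ^ 2) *
        (2 * (1 / h) / n) +
      (M + 1 / (2 * Real.pi) * (∫ t, ‖φ t‖) + 2 * K) *
        deviationBound (∫ y, |y| ∂μ) (1 / h) (accuracy lam (1 / h)) n := by
  have hpi := Real.pi_pos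
  set T := 1 / h with hTdef
  have hT : 0 < T := by positivity
  have hφn : 0 ≤ ∫ t, ‖φ t‖ := integral_nonneg fun _ => norm_nonneg _
  have hM0 : 0 ≤ M := le_trans (by positivity) hM
  have hK0 : 0 ≤ K := (abs_nonneg _).trans (hK 0)
  obtain ⟨B, hBm, hPB, hB⟩ := exists_measurableSet_norm_empCharFun_sub_le hXm hind hlaw hμ hn hT
    (accuracy_pos lam T)
  obtain ⟨hQi, hQ⟩ := integral_integral_norm_empCharFun_sub_sq_le hXm hind hlaw hn hT.le
  set Q := fun ω => ∫ t in (-T)..T, ‖empCharFun (fun i => X i ω) n t - charFun μ t‖ ^ 2 with hQdef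
  have hQ0 (ω : Ω) : 0 ≤ Q ω :=
    intervalIntegral.integral_nonneg (by linarith) fun t _ => by positivity
  set A := 1 / (2 * Real.pi * lam) * Real.exp (4 * lam) * Real.exp (T ^ 2) with hA
  set D := M + 1 / (2 * Real.pi) * (∫ t, ‖φ t‖) + 2 * K with hD
  have hD0 : 0 ≤ D := by positivity
  -- Off `B` the linearization error is quadratic; on `B` each of the three terms is bounded
  -- separately, and `D` is the sum of these bounds.
  have hpt (ω : Ω) : |truncEstimator sincKernelFT lam (fun i => X i ω) n h x (d ω) M -
      biasTerm lam φ x T - linearPart lam φ μ x T n (fun i => X i ω)| ≤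
      A * Q ω + B.indicator (fun _ => D) ω := by
    by_cases hω : ω ∈ B
    · rw [Set.indicator_of_mem hω]
      have h1 := abs_truncEstimator_le (lam := lam) (phiW := sincKernelFT)
        (s := fun i => X i ω) (n := n) (h := h) (x := x) (d := d ω) hM0
      have h2 := abs_biasTerm_le hlam hφc hφi x hT.le
      have h3 := abs_linearPart_le (μ := μ) hK n fun i => X i ω
      have h4 : 0 ≤ A * Q ω := mul_nonneg (by positivity) (hQ0 ω)
      refine (abs_sub _ _).trans ((add_le_add (abs_sub _ _) le_rfl).trans ?_)
      linarith
    · rw [Set.indicator_of_notMem hω, add_zero]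
      have hgood : ∀ t ∈ Set.Icc (-T) T,
          ‖empCharFun (fun i => X i ω) n t * invMixCF lam φ t - 1‖ ≤ 1 / 2 := by
        intro t ht
        refine (norm_ratio_sub_one_le hlam.le hφ hinv ht _).trans ?_
        calc Real.exp (2 * lam) * Real.exp (T ^ 2 / 2) *
              ‖empCharFun (fun i => X i ω) n t - charFun μ t‖
            ≤ Real.exp (2 * lam) * Real.exp (T ^ 2 / 2) * accuracy lam T := by
              gcongr
              exact hB ω hω t ht
          _ = 1 / 2 := by
              rw [accuracy, Real.exp_neg, neg_div, Real.exp_neg]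
              field_simp
      rw [truncEstimator_eq_of_abs_le
        ((abs_plugInEstimator_le hlam hφc hφi hφ0 hn hh x (d ω) hgood).trans hM)]
      have h1 := abs_plugInEstimator_sub_linear_le hlam hφc hφ hφ0 hinv hn hh x (d ω) hgood
      rw [← sub_sub] at h1
      refine h1.trans (le_of_eq ?_)
      rw [hA]
      ring
  have hBi : Integrable (B.indicator fun _ => D) P :=
    (integrable_const D).indicator hBm
  calc ∫ ω, |truncEstimator sincKernelFT lam (fun i => X i ω) n h x (d ω) M -
      biasTerm lam φ x T - linearPart lam φ μ x T n (fun i => X i ω)| ∂P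
      ≤ ∫ ω, (A * Q ω + B.indicator (fun _ => D) ω) ∂P :=
        integral_mono_of_nonneg (ae_of_all _ fun _ => abs_nonneg _) ((hQi.const_mul A).add hBi)
          (ae_of_all _ hpt)
    _ = A * ∫ ω, Q ω ∂P + P.real B * D := by
        rw [integral_add (hQi.const_mul A) hBi, integral_const_mul, integral_indicator_const _ hBm,
          smul_eq_mul]
    _ ≤ A * (2 * T / n) + D * deviationBound (∫ y, |y| ∂μ) T (accuracy lam T) n := by
        rw [mul_comm (P.real B)]
        gcongr
        exact hPB

/-- The truncated estimator is asymptotically normal when the observations are measurable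
functions. -/
theorem tendstoInDistribution_truncEstimator [IsProbabilityMeasure μ]
    (hXm : ∀ i, Measurable (X i)) (hind : iIndepFun X P) (hlaw : ∀ i, P.map (X i) = μ)
    (hμ : Integrable id μ) (hlam : 0 < lam) (hφc : Continuous φ) (hφ : ∀ t, ‖φ t‖ ≤ 1)
    (hφi : Integrable φ) (hφ0 : φ 0 = 1) (hlim : Tendsto φ (cocompact ℝ) (𝓝 0))
    (hinv : ∀ t, charFun μ t * invMixCF lam φ t = 1) (hcf : Tendsto (charFun μ) atTop (𝓝 0))
    {h : ℕ → ℝ} (hpos : ∀ n, 0 < h n) (hT : Tendsto (fun n => 1 / h n) atTop atTop)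
    (hT2 : Tendsto (fun n => (1 / h n) ^ 2 / Real.log n) atTop (𝓝 0)) {C : ℝ} (hC : 0 < C)
    {d : ℕ → Ω → ℝ} (hd : ∀ n, Measurable (d n)) (x : ℝ) {fhat : ℕ → Ω → ℝ}
    (hfhat : ∀ n ω, fhat n ω = truncEstimator sincKernelFT lam (fun i => X i ω) n (h n) x (d n ω)
      (C * Real.log n)) :
    (∀ n, Integrable (fhat n) P) ∧
    TendstoInDistribution (fun (n : ℕ) (ω : Ω) =>
        Real.sqrt n / (h n * Real.exp (1 / (2 * h n ^ 2))) * (fhat n ω - ∫ ω', fhat n ω' ∂P))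
      atTop (id : ℝ → ℝ) (fun _ => P)
      (gaussianReal 0 (Real.toNNReal (Real.exp (2 * lam) / (2 * Real.pi ^ 2 * lam ^ 2)))) := by
  have hpi := Real.pi_pos
  have hfm (n : ℕ) : Measurable (fhat n) := by
    rw [funext (hfhat n)]
    exact measurable_truncEstimator hXm (hd n) n (hpos n) x _
  -- This includes `n = 0`, where `log 0 = 0` makes the truncation level `0`.
  have hfi (n : ℕ) : Integrable (fhat n) P := by
    refine .of_bound (hfm n).aestronglyMeasurable (C * Real.log n) (ae_of_all _ fun ω => ?_)
    rw [hfhat]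
    exact abs_truncEstimator_le (mul_nonneg hC.le (Real.log_natCast_nonneg n))
  refine ⟨hfi, ?_⟩
  set T := fun n => 1 / h n with hTdef
  have hT0 (n : ℕ) : 0 < T n := one_div_pos.2 (hpos n)
  set w := fun n => T n * Real.exp (-T n ^ 2 / 2) with hw
  have hw0 (n : ℕ) : 0 < w n := mul_pos (hT0 n) (Real.exp_pos _)
  have ha (n : ℕ) : Real.sqrt n / (h n * Real.exp (1 / (2 * h n ^ 2))) = √n * w n := by
    have h1 : Real.exp (1 / (2 * h n ^ 2)) * Real.exp (-T n ^ 2 / 2) = 1 := by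
      rw [← Real.exp_add, hTdef]
      have : 1 / (2 * h n ^ 2) + -(1 / h n) ^ 2 / 2 = 0 := by ring
      rw [this, Real.exp_zero]
    have h2 : h n ≠ 0 := (hpos n).ne'
    rw [div_eq_iff (mul_ne_zero h2 (Real.exp_ne_zero _))]
    have h3 : T n * h n = 1 := by rw [hTdef]; exact one_div_mul_cancel h2
    linear_combination (-(√(n : ℝ)) * T n * h n) * h1 + (-√(n : ℝ)) * h3
  simp only [ha]
  -- the central limit theorem for the linearization
  set m := fun n => ∫ y, scaledStat lam φ x (T n) y ∂μ with hm
  set g := fun n y => scaledStat lam φ x (T n) y - m n with hg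
  set S := fun (n : ℕ) (ω : Ω) => (√n)⁻¹ * ∑ k ∈ Finset.range n, g n (X k ω) with hS
  set Ks := 2 * Real.exp (2 * lam) / (Real.pi * lam) with hKs
  have hKs0 : 0 ≤ Ks := by positivity
  have hsm (n : ℕ) : Measurable (scaledStat lam φ x (T n)) :=
    measurable_scaledStat hφc x (hT0 n).le
  have hbdd : ∀ᶠ n in atTop, ∀ y, |scaledStat lam φ x (T n) y| ≤ Ks :=
    hT.eventually (eventually_abs_scaledStat_le hlam hφ x)
  have hm0 : Tendsto m atTop (𝓝 0) :=
    (tendsto_integral_scaledStat hlam hφc hφ hlim hμ hcf x).comp hT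
  have hvar : Tendsto (fun n => ∫ y, g n y ^ 2 ∂μ) atTop
      (𝓝 (Real.toNNReal (Real.exp (2 * lam) / (2 * Real.pi ^ 2 * lam ^ 2)) : ℝ)) := by
    have h1 := ((tendsto_integral_scaledStat_sq hlam hφc hφ hlim hμ hcf x).comp hT).sub
      (hm0.pow 2)
    have e : Real.exp (2 * lam) / (2 * Real.pi ^ 2 * lam ^ 2) =
        (Real.exp lam / (Real.pi * lam)) ^ 2 * (1 / 2) - 0 ^ 2 := by
      rw [two_mul lam, Real.exp_add]
      field_simp
      ring
    rw [Real.coe_toNNReal _ (by positivity), e]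
    refine h1.congr' ?_
    filter_upwards [hbdd] with n hn
    have hi1 : Integrable (scaledStat lam φ x (T n)) μ :=
      .of_bound (hsm n).aestronglyMeasurable Ks (ae_of_all _ hn)
    have hi2 : Integrable (fun y => scaledStat lam φ x (T n) y ^ 2) μ := by
      refine .of_bound ((hsm n).pow_const 2).aestronglyMeasurable (Ks ^ 2)
        (ae_of_all _ fun y => ?_)
      rw [norm_pow]
      exact pow_le_pow_left₀ (norm_nonneg _) (hn y) 2
    have e2 : ∀ y, g n y ^ 2 =
        scaledStat lam φ x (T n) y ^ 2 - (2 * m n * scaledStat lam φ x (T n) y - m n ^ 2) := by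
      intro y
      rw [hg]
      ring
    simp only [e2]
    have hi3 : Integrable (fun y => 2 * m n * scaledStat lam φ x (T n) y - m n ^ 2) μ :=
      (hi1.const_mul _).sub (integrable_const _)
    rw [integral_sub hi2 hi3,
      integral_sub (hi1.const_mul _) (integrable_const _), integral_const_mul]
    simp only [integral_const, probReal_univ, one_smul, Function.comp]
    change _ - m n ^ 2 = _ - (2 * m n * m n - m n ^ 2)
    ring
  have hCLT : TendstoInDistribution S atTop (id : ℝ → ℝ) (fun _ => P) (gaussianReal 0
      (Real.toNNReal (Real.exp (2 * lam) / (2 * Real.pi ^ 2 * lam ^ 2)))) := by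
    refine tendstoInDistribution_sum_triangular hXm hind hlaw (K := Ks + Ks)
      (fun n => (hsm n).sub_const _) ?_ ?_ hvar
    · filter_upwards [hbdd] with n hn y
      have h1 : ‖m n‖ ≤ Ks * μ.real Set.univ :=
        norm_integral_le_of_norm_le_const (ae_of_all _ hn)
      have : |m n| ≤ Ks := by simpa using h1
      exact (abs_sub _ _).trans (add_le_add (hn y) this)
    · filter_upwards [hbdd] with n hn
      have hi1 : Integrable (scaledStat lam φ x (T n)) μ :=
        .of_bound (hsm n).aestronglyMeasurable Ks (ae_of_all _ hn)
      rw [integral_sub hi1 (integrable_const _)]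
      simp [hm]
  have hSm (n : ℕ) : Measurable (S n) :=
    (Finset.measurable_fun_sum _ fun j _ => ((hsm n).sub_const _).comp (hXm j)).const_mul _
  refine tendstoInDistribution_of_tendstoInMeasure_sub _ _ hCLT ?_
    fun n => (((hfm n).sub_const _).const_mul _).aemeasurable
  -- the remainder is negligible in mean
  set Kφ := ∫ t, ‖φ t‖ with hKφ
  have hKφ0 : 0 ≤ Kφ := integral_nonneg fun _ => norm_nonneg _
  set c := 1 / (2 * Real.pi * lam) with hc
  have hmabs : 0 ≤ ∫ y, |y| ∂μ := integral_nonneg fun _ => abs_nonneg _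
  set τ := fun n : ℕ => √n * (T n * Real.exp (-T n ^ 2 / 2)) *
      (c * Real.exp (4 * lam) * Real.exp (T n ^ 2) * (2 * T n / n)) +
    (√n * (T n * Real.exp (-T n ^ 2 / 2)) * (C * Real.log n + 1 / (2 * Real.pi) * Kφ) +
      √n * (2 * Ks)) * deviationBound (∫ y, |y| ∂μ) (T n) (accuracy lam (T n)) n with hτ
  have hτ0 : Tendsto τ atTop (𝓝 (0 + 0)) :=
    (tendsto_quadratic_remainder hT hT2 _).add
      (tendsto_bad_event_contribution hmabs hC.le (by positivity) (by positivity) hT hT2)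
  -- The bound on the plug-in estimator is linear in `T ≤ T² = o(log n)`, so every `C > 0` is
  -- eventually large enough.
  have htrunc : ∀ᶠ n : ℕ in atTop, c * (lam * Kφ + 2 * T n) ≤ C * Real.log n := by
    have h1 : Tendsto (fun n : ℕ => c * lam * Kφ * (Real.log n)⁻¹ +
        2 * c * (T n ^ 2 / Real.log n)) atTop (𝓝 (c * lam * Kφ * 0 + 2 * c * 0)) :=
      ((tendsto_inv_atTop_zero.comp tendsto_log_natCast).const_mul _).add (hT2.const_mul _)
    filter_upwards [h1.eventually (eventually_le_nhds (by simpa using hC :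
      c * lam * Kφ * 0 + 2 * c * 0 < C)), tendsto_log_natCast.eventually_gt_atTop 0,
      hT.eventually_ge_atTop 1] with n hn hlog hT1
    have h2 : c * lam * Kφ * (Real.log n)⁻¹ + 2 * c * (T n ^ 2 / Real.log n) =
        c * (lam * Kφ + 2 * T n ^ 2) / Real.log n := by ring
    rw [h2, div_le_iff₀ hlog] at hn
    refine le_trans ?_ hn
    have h3 : T n ≤ T n ^ 2 := by
      change 1 ≤ T n at hT1
      nlinarith
    gcongr
  have hmain : ∀ᶠ n : ℕ in atTop,
      Integrable (fun ω => √n * w n * (fhat n ω - ∫ ω', fhat n ω' ∂P) - S n ω) P ∧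
      ∫ ω, ‖√n * w n * (fhat n ω - ∫ ω', fhat n ω' ∂P) - S n ω‖ ∂P ≤ 2 * τ n := by
    filter_upwards [hbdd, htrunc, eventually_ne_atTop 0] with n hn htr hn0
    have hn' : 0 < (n : ℝ) := by positivity
    -- Dividing by `w n` costs nothing in the end: the normalization `√n * w n` cancels it and
    -- leaves `√n * (2 * Ks)`.
    have hlin (y : ℝ) : |linStat lam φ x (T n) y| ≤ Ks / w n := by
      rw [le_div_iff₀ (hw0 n), ← abs_of_pos (hw0 n), ← abs_mul, mul_comm]
      exact hn y
    set b := biasTerm lam φ x (T n) with hb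
    set ℓ := fun ω => linearPart lam φ μ x (T n) n fun i => X i ω with hℓ
    have hℓi : Integrable ℓ P :=
      .of_bound (measurable_linearPart hXm hφc x (hT0 n).le n).aestronglyMeasurable
        (2 * (Ks / w n)) (ae_of_all _ fun ω => abs_linearPart_le hlin n _)
    have hℓ0 : ∫ ω, ℓ ω ∂P = 0 := integral_linearPart hXm hlaw hφc (hT0 n).le hlin hn0
    -- Since `b` is deterministic and `ℓ` has mean zero, centring the estimator amounts to centring
    -- `Δ`, which at most doubles its `L¹` norm.
    set Δ := fun ω => fhat n ω - b - ℓ ω with hΔ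
    have hΔi : Integrable Δ P := ((hfi n).sub (integrable_const b)).sub hℓi
    have hΔint : ∫ ω, Δ ω ∂P = ∫ ω, fhat n ω ∂P - b := by
      have h1 : Integrable (fun ω => fhat n ω - b) P := (hfi n).sub (integrable_const b)
      rw [hΔ, integral_sub h1 hℓi,
        integral_sub (hfi n) (integrable_const b), hℓ0]
      simp
    have hSℓ (ω : Ω) : S n ω = √n * w n * ℓ ω := by
      have h1 : (√(n : ℝ))⁻¹ = √n * (1 / n) := by
        rw [eq_comm, mul_one_div, div_eq_iff hn'.ne', inv_mul_eq_div,
          eq_div_iff (Real.sqrt_pos.2 hn').ne', Real.mul_self_sqrt hn'.le]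
      have h2 : m n = w n * ∫ y, linStat lam φ x (T n) y ∂μ := integral_const_mul _ _
      have h3 : ∑ k ∈ Finset.range n, g n (X k ω) =
          w n * ∑ k ∈ Finset.range n, linStat lam φ x (T n) (X k ω) - n * m n := by
        simp only [hg, Finset.sum_sub_distrib, Finset.sum_const, Finset.card_range, nsmul_eq_mul,
          Finset.mul_sum]
        rfl
      simp only [hS, hℓ, linearPart]
      rw [h3, h1, h2]
      field_simp
    have hW (ω : Ω) : √n * w n * (fhat n ω - ∫ ω', fhat n ω' ∂P) - S n ω =
        √n * w n * (Δ ω - ∫ ω', Δ ω' ∂P) := by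
      rw [hSℓ, hΔint, hΔ]
      ring
    simp only [hW]
    refine ⟨(hΔi.sub (integrable_const _)).const_mul _, ?_⟩
    have hΔb := integral_abs_truncEstimator_sub_linear_le hXm hind hlaw hμ hlam hφc hφ hφi hφ0
      hinv hn0 (hpos n) x (d n) htr hlin
    simp only [← hfhat] at hΔb
    have h4 : ∫ ω, |Δ ω - ∫ ω', Δ ω' ∂P| ∂P ≤ 2 * ∫ ω, |Δ ω| ∂P := by
      calc ∫ ω, |Δ ω - ∫ ω', Δ ω' ∂P| ∂P
          ≤ ∫ ω, (|Δ ω| + |∫ ω', Δ ω' ∂P|) ∂P :=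
            integral_mono (hΔi.sub (integrable_const _)).abs
              (hΔi.abs.add (integrable_const _)) fun ω => abs_sub _ _
        _ = ∫ ω, |Δ ω| ∂P + |∫ ω', Δ ω' ∂P| := by
            rw [integral_add hΔi.abs (integrable_const _)]
            simp
        _ ≤ 2 * ∫ ω, |Δ ω| ∂P := by
            linarith [abs_integral_le_integral_abs (f := Δ) (μ := P)]
    have haw : 0 ≤ √(n : ℝ) * w n := mul_nonneg (Real.sqrt_nonneg _) (hw0 n).le
    simp only [norm_mul, Real.norm_eq_abs]
    rw [integral_const_mul, ← abs_mul, abs_of_nonneg haw]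
    calc √(n : ℝ) * w n * ∫ ω, |Δ ω - ∫ ω', Δ ω' ∂P| ∂P
        ≤ √(n : ℝ) * w n * (2 * (c * Real.exp (4 * lam) * Real.exp (T n ^ 2) * (2 * T n / n) +
          (C * Real.log n + 1 / (2 * Real.pi) * Kφ + 2 * (Ks / w n)) *
            deviationBound (∫ y, |y| ∂μ) (T n) (accuracy lam (T n)) n)) := by
          gcongr
          exact h4.trans (mul_le_mul_of_nonneg_left hΔb zero_le_two)
      _ = 2 * τ n := by
          have hwne := (hw0 n).ne'
          change _ = 2 * (√n * w n * (c * Real.exp (4 * lam) * Real.exp (T n ^ 2) * (2 * T n / n)) +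
            (√n * w n * (C * Real.log n + 1 / (2 * Real.pi) * Kφ) + √n * (2 * Ks)) *
              deviationBound (∫ y, |y| ∂μ) (T n) (accuracy lam (T n)) n)
          generalize deviationBound (∫ y, |y| ∂μ) (T n) (accuracy lam (T n)) n = p
          field_simp
  refine tendstoInMeasure_of_tendsto_eLpNorm one_ne_zero (fun n => ?_) aestronglyMeasurable_const
    ?_
  · exact ((((hfm n).sub_const _).const_mul _).sub (hSm n)).aestronglyMeasurable
  · have hlim2 : Tendsto (fun n => ENNReal.ofReal (2 * τ n)) atTop (𝓝 0) := by
      have := ENNReal.tendsto_ofReal (hτ0.const_mul 2)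
      simpa using this
    refine tendsto_of_tendsto_of_tendsto_of_le_of_le' tendsto_const_nhds hlim2
      (Eventually.of_forall fun _ => zero_le) ?_
    filter_upwards [hmain] with n ⟨hi, hle⟩
    rw [sub_zero, eLpNorm_one_eq_lintegral_enorm]
    refine le_trans (le_of_eq ?_) (ENNReal.ofReal_le_ofReal hle)
    rw [ofReal_integral_norm_eq_lintegral_enorm hi]
    rfl

end Main

end GaussDecompounding

/-! ### From the observation model to the analytic hypotheses -/

theorem mainTheorem1
    {Ω : Type*} [MeasurableSpace Ω] (P : Measure Ω) [IsProbabilityMeasure P]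
    -- intensity, jump size distribution and its density
    (lam : ℝ≥0) (hlam : 0 < lam)
    (F : Measure ℝ) [IsProbabilityMeasure F]
    (f : ℝ → ℝ) (hf_meas : Measurable f) (hf_nonneg : ∀ y, 0 ≤ f y)
    (hf_dens : F = volume.withDensity fun y => ENNReal.ofReal (f y))
    -- the sample: i.i.d. observations, each a Poisson sum plus an independent standard normal
    (X Y Z : ℕ → Ω → ℝ)
    (hX : ∀ i ω, X i ω = Y i ω + Z i ω)
    (hY : ∀ i, HasLaw (Y i) (GaussDecompounding.compoundPoisson lam F) P)
    (hZ : ∀ i, HasLaw (Z i) (gaussianReal 0 1) P)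
    (hYZ : ∀ i, IndepFun (Y i) (Z i) P)
    (hindep : iIndepFun X P)
    -- integrability of the characteristic function of the jump size density
    (hphi : Integrable (charFun F))
    -- bandwidth
    (h : ℕ → ℝ) (hpos : ∀ n, 0 < h n)
    (β : ℝ) (hβ0 : 0 < β) (hβ : β < 1 / 2)
    (hh : h ~[atTop] fun n : ℕ => Real.log n ^ (-β))
    -- truncation level
    (C : ℝ) (hC : 0 < C)
    -- moment condition
    (ρ : ℝ) (hρ : 3 / 2 < ρ) (hmom : Integrable fun y : ℝ => |y| ^ ρ * f y)
    -- values of the plug-in estimator where the distinguished logarithm does not exist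
    (d : ℕ → Ω → ℝ) (hd : ∀ n, Measurable (d n))
    (x : ℝ)
    (fhat : ℕ → Ω → ℝ)
    (hfhat : ∀ n ω, fhat n ω =
      GaussDecompounding.truncEstimator GaussDecompounding.sincKernelFT lam
        (fun i => X i ω) n (h n) x (d n ω) (C * Real.log n)) :
    (∀ n, Integrable (fhat n) P) ∧
    TendstoInDistribution
      (fun (n : ℕ) (ω : Ω) =>
        Real.sqrt n / (h n * Real.exp (1 / (2 * h n ^ 2))) * (fhat n ω - ∫ ω', fhat n ω' ∂P))
      atTop (id : ℝ → ℝ) (fun _ => P)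
      (gaussianReal 0
        (Real.toNNReal (Real.exp (2 * lam) / (2 * Real.pi ^ 2 * (lam : ℝ) ^ 2)))) := by
  have hlam' : (0 : ℝ) < lam := hlam
  have hXae (i : ℕ) : AEMeasurable (X i) P := by
    have : X i = Y i + Z i := funext (hX i)
    rw [this]
    exact (hY i).aemeasurable.add (hZ i).aemeasurable
  have hlaw (i : ℕ) : P.map (X i) =
      (GaussDecompounding.compoundPoisson lam F).conv (gaussianReal 0 1) := by
    have : X i = Y i + Z i := funext (hX i)
    rw [this, (hYZ i).map_add_eq_map_conv_map₀ (hY i).aemeasurable (hZ i).aemeasurable,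
      (hY i).map_eq, (hZ i).map_eq]
  set μ := (GaussDecompounding.compoundPoisson lam F).conv (gaussianReal 0 1) with hμdef
  set φ := charFun F with hφdef
  have hcharμ (t : ℝ) : charFun μ t =
      Complex.exp (lam * (φ t - 1)) * Complex.exp (-(t ^ 2 / 2)) := by
    rw [hμdef, charFun_conv, GaussDecompounding.charFun_compoundPoisson, charFun_gaussianReal]
    congr 2
    push_cast
    ring
  have hinv (t : ℝ) : charFun μ t * GaussDecompounding.invMixCF lam φ t = 1 := by
    rw [hcharμ, GaussDecompounding.invMixCF, ← Complex.exp_add, ← Complex.exp_add]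
    refine Eq.trans ?_ Complex.exp_zero
    congr 1
    ring
  have hφ (t : ℝ) : ‖φ t‖ ≤ 1 := norm_charFun_le_one t
  have hφc : Continuous φ := continuous_charFun
  have hφ0 : φ 0 = 1 := by simp [hφdef]
  have hlim := GaussDecompounding.tendsto_charFun_withDensity_cocompact F f hf_meas hf_nonneg hf_dens
  -- The compound Poisson factor has modulus at most `1`, so the Gaussian factor forces decay.
  have hcf : Tendsto (charFun μ) atTop (𝓝 0) := by
    have h1 : Tendsto (fun t : ℝ => t ^ 0 * Real.exp (-t ^ 2 / 2)) atTop (𝓝 0) :=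
      GaussDecompounding.tendsto_pow_mul_exp_neg_sq_half 0
    refine squeeze_zero_norm (fun t => ?_) h1
    rw [hcharμ, norm_mul, Complex.norm_exp, Complex.norm_exp, pow_zero]
    have h2 : ((lam : ℂ) * (φ t - 1)).re ≤ 0 := by
      have h3 : (φ t).re ≤ 1 := (Complex.re_le_norm _).trans (hφ t)
      have h4 : ((lam : ℂ) * (φ t - 1)).re = (lam : ℝ) * ((φ t).re - 1) := by
        have : (lam : ℂ) = ((lam : ℝ) : ℂ) := rfl
        rw [this, Complex.re_ofReal_mul, Complex.sub_re, Complex.one_re]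
      rw [h4]
      exact mul_nonpos_of_nonneg_of_nonpos hlam'.le (by linarith)
    have h5 : (-((t : ℂ) ^ 2 / 2)).re = -t ^ 2 / 2 := by
      have : -((t : ℂ) ^ 2 / 2) = ((-t ^ 2 / 2 : ℝ) : ℂ) := by push_cast; ring
      rw [this, Complex.ofReal_re]
    rw [h5]
    gcongr
    exact Real.exp_le_one_iff.2 h2
  have hFi : Integrable id F :=
    GaussDecompounding.integrable_id_of_rpow_moment F f hf_meas hf_nonneg hf_dens ρ (by linarith) hmom
  have hμi : Integrable id μ := by
    have hYi : Integrable (Y 0) P := by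
      have := GaussDecompounding.integrable_id_compoundPoisson lam F hFi
      rw [← (hY 0).map_eq] at this
      exact this.comp_aemeasurable (hY 0).aemeasurable
    have hZi : Integrable (Z 0) P := by
      have : Integrable id (gaussianReal 0 1) := (memLp_id_gaussianReal 1).integrable (by simp)
      rw [← (hZ 0).map_eq] at this
      exact this.comp_aemeasurable (hZ 0).aemeasurable
    rw [← hlaw 0, integrable_map_measure (by fun_prop) (hXae 0)]
    refine (hYi.add hZi).congr (ae_of_all _ fun ω => ?_)
    simp [hX]
  obtain ⟨hT, hT2⟩ := GaussDecompounding.tendsto_one_div_bandwidth hβ0 hβ hh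
  -- The observations are only almost everywhere measurable. Measurable versions agree with them
  -- simultaneously for all indices off a null set, which changes neither laws, independence,
  -- expectations nor the limit.
  have hae : ∀ᵐ ω ∂P, ∀ i, X i ω = (hXae i).mk (X i) ω :=
    ae_all_iff.2 fun i => (hXae i).ae_eq_mk
  set X' := fun i => (hXae i).mk (X i) with hX'
  set fhat' := fun (n : ℕ) (ω : Ω) => GaussDecompounding.truncEstimator GaussDecompounding.sincKernelFT lam
    (fun i => X' i ω) n (h n) x (d n ω) (C * Real.log n) with hfhat'
  have hff (n : ℕ) : fhat' n =ᵐ[P] fhat n := by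
    filter_upwards [hae] with ω hω
    rw [hfhat, hfhat']
    simp only [hω, hX']
  obtain ⟨hI, hD⟩ := GaussDecompounding.tendstoInDistribution_truncEstimator (X := X')
    (fun i => (hXae i).measurable_mk) (hindep.congr fun i => (hXae i).ae_eq_mk)
    (fun i => by rw [← hlaw i]; exact (Measure.map_congr (hXae i).ae_eq_mk).symm) hμi hlam' hφc hφ
    hphi hφ0 hlim hinv hcf hpos hT hT2 hC hd x (fhat := fhat') fun _ _ => rfl
  refine ⟨fun n => (hI n).congr (hff n), hD.congr (fun n => ?_) (ae_eq_refl _)⟩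
  filter_upwards [hff n] with ω hω
  rw [hω, integral_congr_ae (hff n)]
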